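/- **Setting.** Let $n\ge 2$ and let $\mathfrak m=E\oplus\mathbb R\mathfrak p\oplus\mathbb R\mathfrak q$ be Minkowski space of dimension $n+1$, where $\langle\cdot,\cdot\rangle$ is negative definite on $E$, $\dim E=n-1$, $\mathfrak p,\mathfrak q$ are isotropic and orthogonal to $E$, and $\langle \mathfrak p,\mathfrak q\rangle=1$. Write $e^\flat=\langle e,\cdot\rangle|_E\in E^*$ for $e\in E$. Let $b$ be a non-degenerate symmetric bilinear form on $E$ and define $B\in\mathrm{End}(E)$ by $b(e,f)=-\langle Be,f\rangle$. The Cahen–Wallach algebra $\mathfrak g_b=E^*+(E+\mathbb R\mathfrak p+\mathbb R\mathfrak q)$ is the Lie algebra whose only non-trivial brackets are $[\mathfrak q,e]=e^\flat$, $[e^\flat,f]=b(e,f)\mathfrak p$, $[e^\flat,\mathfrak q]=Be$. Clifford algebras are taken with $v^2=-\langle v,v\rangle$, and $\mathfrak{so}$ is embedded in them by $v\wedge w=\langle v,\cdot\rangle w-\langle w,\cdot\rangle v\mapsto\frac14(vw-wv)$. Let $\rho_{0,n-1}:\mathrm{Cl}_{0,n-1}=\mathrm{Cl}(E)\to\mathrm{End}_{\mathbb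 R}(S_{0,n-1})$ be a real irreducible representation; for $c\in\mathrm{Cl}_{0,n-1}$ write $c$ also for $\rho_{0,n-1}(c)$. Let $S=S_-+S_+=S_{0,n-1}+S_{0,n-1}$, with elements $Q=\binom{Q_-}{Q_+}$, carry the representation $\rho_{\rm spin}$ of $\mathrm{Cl}(\mathfrak m)$ given by $e\mapsto\begin{pmatrix}-e&0\\0&e\end{pmatrix}$ for $e\in E$, $\mathfrak p\mapsto\begin{pmatrix}0&2\sqrt2\\0&0\end{pmatrix}$, $\mathfrak q\mapsto\begin{pmatrix}0&0\\-1/\sqrt2&0\end{pmatrix}$. A *superization* of $\mathfrak g_b$ is a real Lie superalgebra $\mathfrak g=\mathfrak g_{\bar0}+\mathfrak g_{\bar1}$ with $\mathfrak g_{\bar0}=\mathfrak g_b$ and $\mathfrak g_{\bar1}=S$ such that $\mathrm{ad}_{e^\flat}|_S=\rho_{\rm spin}(\mathfrak p\wedge Be)$ for all $e\in E$. It has *zero charge* if $\mathrm{ad}_{\mathfrak p}|_S=0$ and, as is part of the convention for zero charge, $\mathrm{ad}_{v}|_S\in\rho_{\rm spin}(\mathrm{Cl}(\mathfrak m))$ for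 all $v\in\mathfrak m$. It has *translational supersymmetry* if $[S,S]\subseteq\mathfrak m$. If the $\mathfrak{so}(E)$-module $S_{0,n-1}$ is reducible, fix a decomposition $S_{0,n-1}=S^-+S^+$ into semi-spinors, i.e. complementary irreducible $\mathfrak{so}(E)$-submodules which are exchanged by Clifford multiplication by vectors of $E$. An $\mathfrak{so}(E)$-invariant bilinear form $\Gamma$ on $S_{0,n-1}$ is *admissible* with invariants $\tau,\sigma\in\{\pm1\}$ if $\Gamma(v s,t)=\tau\,\Gamma(s,v t)$ for $v\in E$, $\Gamma(s,t)=\sigma\,\Gamma(t,s)$ and, when $S_{0,n-1}$ is a reducible $\mathfrak{so}(E)$-module, $S^\pm$ are either mutually orthogonal or both isotropic for $\Gamma$. Let $\mathrm{Bil}(S_{0,n-1})^{\tau\sigma=-1}$ be the vector space spanned by the admissible forms with $\tau\sigma=-1$. A pair $(c_1,c_2)\in(\mathrm{Cl}_{0,n-1})^2$ solves the *quadratic Clifford equation* if $(L_{c_1}-R_{c_2})^2E\subseteq E$ and $(L_{c_1}-R_{c_2})^2|_E=-B$, where $L_c$ and $R_c$ denote left and right multiplication by $c$. **Theorem 5.1.**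 Consider the data $(c_1,c_2,c_3,p_{-+},p_{++})$ consisting of a solution $(c_1,c_2)\in(\mathrm{Cl}_{0,n-1})^2$ of the quadratic Clifford equation, an element $c_3\in\mathrm{Cl}_{0,n-1}$, a form $p_{-+}\in\mathrm{Bil}(S_{0,n-1})^{\tau\sigma=-1}$ and a symmetric bilinear form $p_{++}$ on $S_{0,n-1}$, which satisfy for all $s,t\in S_{0,n-1}$ $$p_{-+}(c_3s,t)+p_{-+}(c_3t,s)+p_{++}(c_2s,t)+p_{++}(s,c_2t)=0,\qquad p_{-+}(c_1s,t)+p_{-+}(s,c_2t)=0.$$ 1. For all such data there is exactly one superization of $\mathfrak g_b$ with $$\mathrm{ad}_{\mathfrak p}|_S=0,\quad \mathrm{ad}_{\mathfrak q}|_S=\begin{pmatrix}c_1&c_3\\0&c_2\end{pmatrix},\quad \mathrm{ad}_{e^\flat}|_S=\sqrt2\begin{pmatrix}0&Be\\0&0\end{pmatrix},\quad \mathrm{ad}_e|_S=\sqrt2\begin{pmatrix}0&e\circ c_2-c_1\circ e\\0&0\end{pmatrix}\quad(e\in E),$$ $$[Q,Q]=\bigl(p_{++}(Q_+,Q_+)+2p_{-+}(Q_-,Q_+)\bigr)\mathfrak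 p\quad(Q\in S),$$ and it has zero charge and translational supersymmetry. 2. Every zero charge superization of $\mathfrak g_b$ with translational supersymmetry is given by these formulas for some such data. 3. Two such data $(c_1,c_2,c_3,p_{-+},p_{++})$ and $(c_1',c_2',c_3',p_{-+}',p_{++}')$ define the same superization if and only if $p_{-+}=p_{-+}'$, $p_{++}=p_{++}'$ and $c_i-c_i'\in\ker\rho_{0,n-1}$ for $i=1,2,3$. -/

import Mathlib

noncomputable section

namespace CahenWallach

/-! ### Clifford algebras with the convention `v * v = -⟨v, v⟩` -/

/-- The quadratic form `v ↦ -⟨v, v⟩` attached to a scalar product `⟨·, ·⟩`. -/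
def clForm {M : Type*} [AddCommGroup M] [Module ℝ M] (g : LinearMap.BilinForm ℝ M) :
    QuadraticForm ℝ M :=
  LinearMap.BilinMap.toQuadraticMap (-g)

/-- The Clifford algebra of `(M, g)`: the tensor algebra of `M` modulo `v ⊗ v + ⟨v, v⟩`. -/
abbrev Cl {M : Type*} [AddCommGroup M] [Module ℝ M] (g : LinearMap.BilinForm ℝ M) : Type _ :=
  CliffordAlgebra (clForm g)

/-- The inclusion of `M` into its Clifford algebra. -/
abbrev vec {M : Type*} [AddCommGroup M] [Module ℝ M] (g : LinearMap.BilinForm ℝ M) :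
    M →ₗ[ℝ] Cl g :=
  CliffordAlgebra.ι (clForm g)

/-- The image `[v, w] / 4` of `v ∧ w = ⟨v, ·⟩ w - ⟨w, ·⟩ v ∈ so(M)` under the natural embedding of
`so(M)` into the Clifford algebra. -/
def soCl {M : Type*} [AddCommGroup M] [Module ℝ M] (g : LinearMap.BilinForm ℝ M) (v w : M) :
    Cl g :=
  (1 / 4 : ℝ) • (vec g v * vec g w - vec g w * vec g v)

theorem clForm_apply {M : Type*} [AddCommGroup M] [Module ℝ M] (g : LinearMap.BilinForm ℝ M)
    (v : M) : clForm g v = -g v v := rfl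

/-! ### The Minkowski space `𝔪 = E ⊕ ℝp ⊕ ℝq` -/

section Minkowski

variable (E : Type*) [NormedAddCommGroup E] [InnerProductSpace ℝ E]

/-- The negative definite scalar product `⟨·, ·⟩` on the Euclidean space `E`. -/
def euc : LinearMap.BilinForm ℝ E := -innerₗ E

theorem euc_apply (e f : E) : euc E e f = -inner ℝ e f := rfl

theorem euc_nondegenerate : (euc E).Nondegenerate := by
  refine ⟨fun e he => ?_, fun e he => ?_⟩
  all_goals
    have h := he e
    rw [euc_apply, neg_eq_zero] at h
    exact inner_self_eq_zero.mp h

/-- The vector space underlying `𝔪`: the triple `(e, a, s)` stands for `e + a p + s q`. -/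
abbrev Mink : Type _ := E × ℝ × ℝ

/-- The Lorentzian scalar product on `𝔪`: it restricts to `⟨·, ·⟩` on `E`, the vectors `p` and `q`
are isotropic and orthogonal to `E`, and `⟨p, q⟩ = 1`. -/
def mink : LinearMap.BilinForm ℝ (Mink E) :=
  LinearMap.mk₂ ℝ (fun v w => euc E v.1 w.1 + v.2.1 * w.2.2 + v.2.2 * w.2.1)
    (by intro v v' w; simp; ring) (by intro c v w; simp; ring)
    (by intro v w w'; simp; ring) (by intro c v w; simp; ring)

theorem mink_apply (v w : Mink E) :
    mink E v w = euc E v.1 w.1 + v.2.1 * w.2.2 + v.2.2 * w.2.1 := rfl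

variable [FiniteDimensional ℝ E]

/-- The musical isomorphism `e ↦ e♭ = ⟨e, ·⟩`; its inverse is `♯`. -/
def flat : E ≃ₗ[ℝ] Module.Dual ℝ E := (euc E).toDual (euc_nondegenerate E)

theorem flat_apply (e f : E) : flat E e f = euc E e f := rfl

end Minkowski

/-! ### The Cahen-Wallach Lie algebra -/

/-- A non-degenerate symmetric bilinear form `b` on `E`. -/
structure CWForm (E : Type*) [NormedAddCommGroup E] [InnerProductSpace ℝ E] where
  form : LinearMap.BilinForm ℝ E
  symm : ∀ e f, form e f = form f e
  nondeg : form.Nondegenerate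

section Algebra

variable {E : Type*} [NormedAddCommGroup E] [InnerProductSpace ℝ E]

/-- The endomorphism `B` of `E` defined by `b(e, f) = -⟨B e, f⟩`. -/
def CWForm.B [FiniteDimensional ℝ E] (b : CWForm E) : E →ₗ[ℝ] E := -((flat E).symm.toLinearMap ∘ₗ b.form)

theorem CWForm.form_eq [FiniteDimensional ℝ E] (b : CWForm E) (e f : E) : b.form e f = -euc E (b.B e) f := by
  have h : flat E ((flat E).symm (b.form e)) f = b.form e f := by simp
  rw [flat_apply] at h
  simp [CWForm.B, h]

/-- The vector space `E* + (E + ℝp + ℝq)` underlying the Cahen-Wallach algebra: the pair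
`(ξ, (e, a, s))` stands for `ξ + e + a p + s q`. -/
def CWAlg (_b : CWForm E) : Type _ := Module.Dual ℝ E × Mink E

variable (b : CWForm E)

instance : AddCommGroup (CWAlg b) := inferInstanceAs (AddCommGroup (Module.Dual ℝ E × Mink E))

instance : Module ℝ (CWAlg b) := inferInstanceAs (Module ℝ (Module.Dual ℝ E × Mink E))

/-- The inclusion of `𝔥 = E*`. -/
def inDual : Module.Dual ℝ E →ₗ[ℝ] CWAlg b := LinearMap.inl ℝ (Module.Dual ℝ E) (Mink E)

/-- The inclusion of `𝔪`. -/
def inMink : Mink E →ₗ[ℝ] CWAlg b := LinearMap.inr ℝ (Module.Dual ℝ E) (Mink E)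

/-- The inclusion of `E`. -/
def inE (e : E) : CWAlg b := inMink b (e, 0, 0)

/-- The central element `p`. -/
def elP : CWAlg b := inMink b (0, 1, 0)

/-- The element `q`. -/
def elQ : CWAlg b := inMink b (0, 0, 1)

theorem CWAlg.ext {x y : CWAlg b} (h1 : x.1 = y.1) (h2 : x.2.1 = y.2.1)
    (h3 : x.2.2.1 = y.2.2.1) (h4 : x.2.2.2 = y.2.2.2) : x = y :=
  Prod.ext h1 (Prod.ext h2 (Prod.ext h3 h4))

theorem add_c1 (x y : CWAlg b) : (x + y).1 = x.1 + y.1 := rfl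
theorem add_c2 (x y : CWAlg b) : (x + y).2.1 = x.2.1 + y.2.1 := rfl
theorem add_c3 (x y : CWAlg b) : (x + y).2.2.1 = x.2.2.1 + y.2.2.1 := rfl
theorem add_c4 (x y : CWAlg b) : (x + y).2.2.2 = x.2.2.2 + y.2.2.2 := rfl
theorem smul_c1 (r : ℝ) (x : CWAlg b) : (r • x).1 = r • x.1 := rfl
theorem smul_c2 (r : ℝ) (x : CWAlg b) : (r • x).2.1 = r • x.2.1 := rfl
theorem smul_c3 (r : ℝ) (x : CWAlg b) : (r • x).2.2.1 = r * x.2.2.1 := rfl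
theorem smul_c4 (r : ℝ) (x : CWAlg b) : (r • x).2.2.2 = r * x.2.2.2 := rfl

variable [FiniteDimensional ℝ E]

/-- The bilinear skew-symmetric bracket with `[q, e] = e♭`, `[e♭, f] = b(e, f) p`,
`[e♭, q] = B e`, all other brackets of elements of `E*`, `E`, `p`, `q` being zero. -/
def cwBracket (x y : CWAlg b) : CWAlg b :=
  (x.2.2.2 • flat E y.2.1 - y.2.2.2 • flat E x.2.1,
    (y.2.2.2 • b.B ((flat E).symm x.1) - x.2.2.2 • b.B ((flat E).symm y.1),
      b.form ((flat E).symm x.1) y.2.1 - b.form ((flat E).symm y.1) x.2.1, 0))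

theorem br_c1 (x y : CWAlg b) :
    (cwBracket b x y).1 = x.2.2.2 • flat E y.2.1 - y.2.2.2 • flat E x.2.1 := rfl
theorem br_c2 (x y : CWAlg b) : (cwBracket b x y).2.1 =
    y.2.2.2 • b.B ((flat E).symm x.1) - x.2.2.2 • b.B ((flat E).symm y.1) := rfl
theorem br_c3 (x y : CWAlg b) : (cwBracket b x y).2.2.1 =
    b.form ((flat E).symm x.1) y.2.1 - b.form ((flat E).symm y.1) x.2.1 := rfl
theorem br_c4 (x y : CWAlg b) : (cwBracket b x y).2.2.2 = 0 := rfl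

instance : LieRing (CWAlg b) where
  bracket := cwBracket b
  add_lie x y z := by
    refine CWAlg.ext b ?_ ?_ ?_ ?_ <;>
      simp only [br_c1, br_c2, br_c3, br_c4, add_c1, add_c2, add_c3, add_c4, map_add,
        LinearMap.add_apply] <;> module
  lie_add x y z := by
    refine CWAlg.ext b ?_ ?_ ?_ ?_ <;>
      simp only [br_c1, br_c2, br_c3, br_c4, add_c1, add_c2, add_c3, add_c4, map_add,
        LinearMap.add_apply] <;> module
  lie_self x := by
    refine CWAlg.ext b ?_ ?_ ?_ ?_ <;> simp only [br_c1, br_c2, br_c3, br_c4, sub_self] <;> rfl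
  leibniz_lie x y z := by
    have h4 := b.symm x.2.1 y.2.1
    have h5 := b.symm x.2.1 z.2.1
    have h6 := b.symm y.2.1 z.2.1
    have k1 : ∀ u v, b.form u (b.B v) = b.form v (b.B u) := by
      intro u v
      rw [b.form_eq, b.form_eq, euc_apply, euc_apply, real_inner_comm]
    have k2 := k1 ((flat E).symm x.1) ((flat E).symm y.1)
    have k3 := k1 ((flat E).symm x.1) ((flat E).symm z.1)
    have k4 := k1 ((flat E).symm y.1) ((flat E).symm z.1)
    refine CWAlg.ext b ?_ ?_ ?_ ?_ <;>
      simp only [br_c1, br_c2, br_c3, br_c4, add_c1, add_c2, add_c3, add_c4, map_sub,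
        map_smul, LinearMap.sub_apply, LinearMap.smul_apply, smul_eq_mul,
        LinearEquiv.symm_apply_apply]
    · module
    · module
    · rw [h4, h5, h6, k2, k3, k4]; ring
    · ring

instance : LieAlgebra ℝ (CWAlg b) where
  lie_smul r x y := by
    change cwBracket b x (r • y) = r • cwBracket b x y
    refine CWAlg.ext b ?_ ?_ ?_ ?_ <;>
      simp only [br_c1, br_c2, br_c3, br_c4, smul_c1, smul_c2, smul_c3, smul_c4, map_smul,
        LinearMap.smul_apply, smul_eq_mul]
    · module
    · module
    · ring
    · ring

theorem lie_def (x y : CWAlg b) : ⁅x, y⁆ = cwBracket b x y := rfl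

end Algebra

/-! ### Spin modules -/

section Spin

variable {E : Type*} [NormedAddCommGroup E] [InnerProductSpace ℝ E]
variable {V : Type*} [AddCommGroup V] [Module ℝ V]

/-- `V` is a real irreducible `Cl(E)`-module, i.e. a model of the spin module `S_{0,n-1}`. -/
def IsSpinModule (ρ : Cl (euc E) →ₐ[ℝ] Module.End ℝ V) : Prop :=
  Nontrivial V ∧
    ∀ W : Submodule ℝ V, (∀ c, ∀ s ∈ W, ρ c s ∈ W) → W = ⊥ ∨ W = ⊤

/-- The endomorphism of `S = S₋ + S₊ = V + V` with the block matrix `(x y; z t)`. -/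
def block (x y z t : Module.End ℝ V) : Module.End ℝ (V × V) :=
  (x ∘ₗ LinearMap.fst ℝ V V + y ∘ₗ LinearMap.snd ℝ V V).prod
    (z ∘ₗ LinearMap.fst ℝ V V + t ∘ₗ LinearMap.snd ℝ V V)

theorem block_apply (x y z t : Module.End ℝ V) (Q : V × V) :
    block x y z t Q = (x Q.1 + y Q.2, z Q.1 + t Q.2) := rfl

/-- The action of the vectors of `𝔪` on `S = V + V`: a vector `e` of `E` acts by `(-e 0; 0 e)`,
`p` by `(0 2√2; 0 0)` and `q` by `(0 0; -1/√2 0)`. -/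
def minkAct (ρ : Cl (euc E) →ₐ[ℝ] Module.End ℝ V) : Mink E →ₗ[ℝ] Module.End ℝ (V × V) where
  toFun v := block (-ρ (vec _ v.1)) ((2 * √2 * v.2.1) • 1) ((-(1 / √2) * v.2.2) • 1)
    (ρ (vec _ v.1))
  map_add' v w := by
    refine LinearMap.ext fun Q => Prod.ext ?_ ?_ <;> simp [block_apply] <;> module
  map_smul' r v := by
    refine LinearMap.ext fun Q => Prod.ext ?_ ?_ <;> simp [block_apply] <;> module

theorem minkAct_sq (ρ : Cl (euc E) →ₐ[ℝ] Module.End ℝ V) (v : Mink E) :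
    minkAct ρ v * minkAct ρ v = algebraMap ℝ _ (clForm (mink E) v) := by
  have h : ∀ s : V, ρ (vec _ v.1) (ρ (vec _ v.1) s) = (-euc E v.1 v.1) • s := by
    intro s
    have h1 : ρ (vec (euc E) v.1 * vec (euc E) v.1) s = (-euc E v.1 v.1) • s := by
      rw [CliffordAlgebra.ι_sq_scalar, clForm_apply, AlgHom.commutes]
      rfl
    rw [← h1, map_mul]; rfl
  have h2 : 2 * √2 * v.2.1 * (-(1 / √2) * v.2.2) = -2 * v.2.1 * v.2.2 := by
    have : √2 ≠ 0 := by positivity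
    field_simp
  have h3 : clForm (mink E) v = -euc E v.1 v.1 + 2 * √2 * v.2.1 * (-(1 / √2) * v.2.2) := by
    rw [h2, clForm_apply, mink_apply]; ring
  refine LinearMap.ext fun Q => ?_
  rw [h3, Module.algebraMap_end_apply]
  refine Prod.ext ?_ ?_
  · change -ρ (vec _ v.1) (-ρ (vec _ v.1) Q.1 + (2 * √2 * v.2.1) • Q.2) + (2 * √2 * v.2.1) •
      ((-(1 / √2) * v.2.2) • Q.1 + ρ (vec _ v.1) Q.2) = _ • Q.1
    rw [map_add, map_neg, map_smul, h]
    module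
  · change (-(1 / √2) * v.2.2) • (-ρ (vec _ v.1) Q.1 + (2 * √2 * v.2.1) • Q.2) + ρ (vec _ v.1)
      ((-(1 / √2) * v.2.2) • Q.1 + ρ (vec _ v.1) Q.2) = _ • Q.2
    rw [map_add, map_smul, h]
    module

/-- The spin representation of `Cl(𝔪)` on `S = V + V`. -/
def spinRep (ρ : Cl (euc E) →ₐ[ℝ] Module.End ℝ V) :
    Cl (mink E) →ₐ[ℝ] Module.End ℝ (V × V) :=
  CliffordAlgebra.lift _ ⟨minkAct ρ, minkAct_sq ρ⟩

/-- The operator `ρ_spin(i_b(ξ))` on `S`, where `i_b(e♭) = p ∧ B e` is the isotropy representation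
of `E*`, given by the adjoint action of `E*` on `𝔪`. -/
def isotropySpin [FiniteDimensional ℝ E] (b : CWForm E) (ρ : Cl (euc E) →ₐ[ℝ] Module.End ℝ V)
    (ξ : Module.Dual ℝ E) : Module.End ℝ (V × V) :=
  spinRep ρ (soCl (mink E) (0, 1, 0) (b.B ((flat E).symm ξ), 0, 0))

/-- `W` is an `so(E)`-submodule of `V`. -/
def SoStable (ρ : Cl (euc E) →ₐ[ℝ] Module.End ℝ V) (W : Submodule ℝ V) : Prop :=
  ∀ v w : E, ∀ s ∈ W, ρ (soCl (euc E) v w) s ∈ W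

/-- `W` is an irreducible `so(E)`-submodule of `V`. -/
def SoIrreducible (ρ : Cl (euc E) →ₐ[ℝ] Module.End ℝ V) (W : Submodule ℝ V) : Prop :=
  SoStable ρ W ∧ W ≠ ⊥ ∧ ∀ U ≤ W, SoStable ρ U → U = ⊥ ∨ U = W

/-- `V = S⁻ + S⁺` is a decomposition into semi-spinors: `S⁻` and `S⁺` are complementary
irreducible `so(E)`-submodules, and Clifford multiplication by vectors exchanges them. -/
structure IsSemispinorSplitting (ρ : Cl (euc E) →ₐ[ℝ] Module.End ℝ V)
    (Sm Sp : Submodule ℝ V) : Prop where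
  compl : IsCompl Sm Sp
  irr_minus : SoIrreducible ρ Sm
  irr_plus : SoIrreducible ρ Sp
  odd_minus : ∀ v : E, ∀ s ∈ Sm, ρ (vec _ v) s ∈ Sp
  odd_plus : ∀ v : E, ∀ s ∈ Sp, ρ (vec _ v) s ∈ Sm

/-- Admissible bilinear forms on `V` of type `τ` and symmetry `σ`. The semi-spinors `Sm`, `Sp`
only matter when the `so(E)`-module `V` is reducible. -/
structure IsAdmissible (ρ : Cl (euc E) →ₐ[ℝ] Module.End ℝ V) (Sm Sp : Submodule ℝ V)
    (τ σ : ℤˣ) (Γ : LinearMap.BilinForm ℝ V) : Prop where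
  invariant : ∀ (v w : E) (s t : V),
    Γ (ρ (soCl (euc E) v w) s) t + Γ s (ρ (soCl (euc E) v w) t) = 0
  type : ∀ (v : E) (s t : V), Γ (ρ (vec _ v) s) t = (τ : ℤ) * Γ s (ρ (vec _ v) t)
  symmetry : ∀ s t : V, Γ s t = (σ : ℤ) * Γ t s
  isotropy : ¬ SoIrreducible ρ (⊤ : Submodule ℝ V) →
    (∀ s ∈ Sm, ∀ t ∈ Sp, Γ s t = 0 ∧ Γ t s = 0) ∨
      ((∀ s ∈ Sm, ∀ t ∈ Sm, Γ s t = 0) ∧ ∀ s ∈ Sp, ∀ t ∈ Sp, Γ s t = 0)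

/-- The vector space of bilinear forms on `V` spanned by the admissible ones with `τσ = -1`. -/
def bilTauSigmaNeg (ρ : Cl (euc E) →ₐ[ℝ] Module.End ℝ V) (Sm Sp : Submodule ℝ V) :
    Submodule ℝ (LinearMap.BilinForm ℝ V) :=
  Submodule.span ℝ {Γ | ∃ τ σ : ℤˣ, τ * σ = -1 ∧ IsAdmissible ρ Sm Sp τ σ Γ}

end Spin

/-! ### Lie superalgebras and superizations -/

/-- The homogeneous parts of the `ℤ/2`-graded vector space `A₀ + A₁`. -/
def parityPart (A₀ A₁ : Type*) [AddCommGroup A₀] [Module ℝ A₀] [AddCommGroup A₁] [Module ℝ A₁]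
    (i : ZMod 2) : Submodule ℝ (A₀ × A₁) :=
  if i = 0 then LinearMap.range (LinearMap.inl ℝ A₀ A₁) else LinearMap.range (LinearMap.inr ℝ A₀ A₁)

/-- Real Lie superalgebra structures on the `ℤ/2`-graded vector space `A₀ + A₁`. -/
structure LieSuperalgebraOn (A₀ A₁ : Type*) [AddCommGroup A₀] [Module ℝ A₀] [AddCommGroup A₁]
    [Module ℝ A₁] where
  br : (A₀ × A₁) →ₗ[ℝ] (A₀ × A₁) →ₗ[ℝ] (A₀ × A₁)
  graded : ∀ i j : ZMod 2, ∀ x ∈ parityPart A₀ A₁ i, ∀ y ∈ parityPart A₀ A₁ j,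
    br x y ∈ parityPart A₀ A₁ (i + j)
  skew : ∀ i j : ZMod 2, ∀ x ∈ parityPart A₀ A₁ i, ∀ y ∈ parityPart A₀ A₁ j,
    br x y = -((-1 : ℝ) ^ (i.val * j.val) • br y x)
  jacobi : ∀ i j : ZMod 2, ∀ x ∈ parityPart A₀ A₁ i, ∀ y ∈ parityPart A₀ A₁ j, ∀ z,
    br x (br y z) = br (br x y) z + (-1 : ℝ) ^ (i.val * j.val) • br y (br x z)

section Superization

variable {E : Type*} [NormedAddCommGroup E] [InnerProductSpace ℝ E] [FiniteDimensional ℝ E]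
variable {V : Type*} [AddCommGroup V] [Module ℝ V]

/-- Superizations of the Cahen-Wallach algebra: Lie superalgebras whose even part is this Lie
algebra, whose odd part is `S = V + V`, and such that the adjoint action of the even part on the
odd part is a spin representation. -/
structure Superization (b : CWForm E) (ρ : Cl (euc E) →ₐ[ℝ] Module.End ℝ V)
    extends LieSuperalgebraOn (CWAlg b) (V × V) where
  even_part : ∀ x y : CWAlg b, br (x, 0) (y, 0) = (⁅x, y⁆, 0)
  spin : ∀ (ξ : Module.Dual ℝ E) (Q : V × V),
    br (inDual b ξ, 0) (0, Q) = (0, isotropySpin b ρ ξ Q)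

variable {b : CWForm E} {ρ : Cl (euc E) →ₐ[ℝ] Module.End ℝ V}

/-- The adjoint action `ad_x|_S` of an even element on the odd part. -/
def Superization.adOdd (g : Superization b ρ) (x : CWAlg b) : Module.End ℝ (V × V) :=
  LinearMap.snd ℝ (CWAlg b) (V × V) ∘ₗ g.br (x, 0) ∘ₗ LinearMap.inr ℝ (CWAlg b) (V × V)

/-- The bracket of two odd elements. -/
def Superization.oddBr (g : Superization b ρ) (Q Q' : V × V) : CWAlg b :=
  (g.br (0, Q) (0, Q')).1

/-- `g` is a zero charge superization with translational supersymmetry. As is part of the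
convention for zero charge, `𝔪` is required to act on `S` through elements of `Cl(𝔪)`. -/
structure Superization.IsZeroChargeTranslational (g : Superization b ρ) : Prop where
  zero_charge : g.adOdd (elP b) = 0
  clifford : ∀ v : Mink E, ∃ c : Cl (mink E), g.adOdd (inMink b v) = spinRep ρ c
  translational : ∀ Q Q' : V × V, ∃ v : Mink E, g.oddBr Q Q' = inMink b v

/-- The quadratic Clifford equation: `(L_{c₁} - R_{c₂})² E ⊆ E`, and the restriction of
`(L_{c₁} - R_{c₂})²` to `E` is `-B`. -/
def QuadraticClifford (b : CWForm E) (c₁ c₂ : Cl (euc E)) : Prop :=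
  (∀ e : E, ((LinearMap.mulLeft ℝ c₁ - LinearMap.mulRight ℝ c₂) ^ 2) (vec _ e) ∈
    LinearMap.range (vec (euc E))) ∧
  ∀ e : E, ((LinearMap.mulLeft ℝ c₁ - LinearMap.mulRight ℝ c₂) ^ 2) (vec _ e) = -vec _ (b.B e)

/-- The data: a solution `(c₁, c₂)` of the quadratic Clifford equation, an element `c₃`, a form
`p_{-+}` in the space spanned by the admissible forms with `τσ = -1`, a symmetric form `p_{++}`,
and the two compatibility conditions. -/
structure SuperizationData (b : CWForm E) (ρ : Cl (euc E) →ₐ[ℝ] Module.End ℝ V)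
    (Sm Sp : Submodule ℝ V) where
  c₁ : Cl (euc E)
  c₂ : Cl (euc E)
  c₃ : Cl (euc E)
  pmp : LinearMap.BilinForm ℝ V
  ppp : LinearMap.BilinForm ℝ V
  quadratic : QuadraticClifford b c₁ c₂
  pmp_mem : pmp ∈ bilTauSigmaNeg ρ Sm Sp
  ppp_symm : ∀ s t, ppp s t = ppp t s
  compat₁ : ∀ s t, pmp (ρ c₃ s) t + pmp (ρ c₃ t) s + ppp (ρ c₂ s) t + ppp s (ρ c₂ t) = 0
  compat₂ : ∀ s t, pmp (ρ c₁ s) t + pmp s (ρ c₂ t) = 0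

/-- The superization `g` is given by the explicit formulas in terms of the data `D`. -/
structure Superization.IsGivenBy {Sm Sp : Submodule ℝ V} (g : Superization b ρ)
    (D : SuperizationData b ρ Sm Sp) : Prop where
  ad_p : g.adOdd (elP b) = 0
  ad_q : g.adOdd (elQ b) = block (ρ D.c₁) (ρ D.c₃) 0 (ρ D.c₂)
  ad_dual : ∀ e : E, g.adOdd (inDual b (flat E e)) = √2 • block 0 (ρ (vec _ (b.B e))) 0 0
  ad_E : ∀ e : E, g.adOdd (inE b e) =
    √2 • block 0 (ρ (vec _ e) ∘ₗ ρ D.c₂ - ρ D.c₁ ∘ₗ ρ (vec _ e)) 0 0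
  odd : ∀ Q : V × V, g.oddBr Q Q = (D.ppp Q.2 Q.2 + 2 * D.pmp Q.1 Q.2) • elP b

end Superization

end CahenWallach

end

noncomputable section

namespace CahenWallach

open CliffordAlgebra

/-! ### Graded simplicity of the Clifford algebra of a Euclidean space -/

section CliffordStructure

variable {E : Type*} [NormedAddCommGroup E] [InnerProductSpace ℝ E]

/-! Everything is governed by `ad_q`. Since `[e♭, q] = B e` and `B` is bijective, the prescribed
action of `E*` together with `ad_q` determines the action of `E`. The image of `Cl(𝔪)` consists of
the 2 × 2 matrices over the image of `Cl(E)`, so `ad_q` is such a matrix. As `p` acts by zero, `[e♭,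
e] = b(e, e) p` kills its lower left block, and `[q, e] = e♭` becomes the quadratic Clifford
equation for the diagonal blocks.

This equation is only obtained after applying `ρ`, which need not be injective, whereas the data
require it in `Cl(E)` itself. The gap is closed by the graded simplicity of `Cl(E)`. If `ρ` is not
injective, the even part has the same image as the whole algebra and the kernel has no non-zero odd
element. With even lifts of the diagonal blocks the defect of the equation on a vector is odd and
lies in the kernel, so it vanishes (`exists_quadraticClifford_lift`).

For the odd bracket, equivariance under `q` and `E` leaves only multiples of the central `p`; the
coefficient is an invariant symmetric form on `S`. Invariance under `E*` makes it vanish on `S₋` and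
makes `p_{-+}(v s, t)` skew in `s`, `t`. Such forms are exactly the span of the admissible ones with
`τσ = -1` (`isVecSkew_of_mem`, `IsVecSkew.mem_bilTauSigmaNeg`). Invariance under `q` gives the two
compatibility conditions.

Conversely, the quadratic equation makes the formulas a representation (`action_lie`), the
compatibility conditions make the form invariant (`pairing_invariant`), and the odd Jacobi identity
is trivial because odd brackets lie in `ℝp`, which acts by zero. -/

theorem vec_mul_self (e : E) :
    vec (euc E) e * vec (euc E) e = algebraMap ℝ _ (inner ℝ e e) := by
  rw [ι_sq_scalar, clForm_apply, euc_apply, neg_neg]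

theorem vec_anticomm (e f : E) :
    vec (euc E) e * vec (euc E) f + vec (euc E) f * vec (euc E) e =
      algebraMap ℝ _ (2 * inner ℝ e f) := by
  rw [ι_mul_ι_add_swap]
  congr 1
  simp only [QuadraticMap.polar, clForm_apply, euc_apply, neg_neg, inner_add_left,
    inner_add_right, real_inner_comm e f]
  ring

theorem vec_mul_of_orthogonal {e f : E} (h : inner ℝ e f = 0) :
    vec (euc E) e * vec (euc E) f = -(vec (euc E) f * vec (euc E) e) := by
  rw [eq_neg_iff_add_eq_zero, vec_anticomm, h, mul_zero, map_zero]

/-- The span of the products of subfamilies of a list of vectors. -/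
def productSpan : List E → Submodule ℝ (Cl (euc E))
  | [] => Submodule.span ℝ {1}
  | e :: l => productSpan l ⊔ (productSpan l).map (LinearMap.mulLeft ℝ (vec (euc E) e))

theorem mem_productSpan_cons {e : E} {l : List E} {x : Cl (euc E)} :
    x ∈ productSpan (e :: l) ↔
      ∃ a ∈ productSpan l, ∃ c ∈ productSpan l, x = a + vec (euc E) e * c := by
  simp only [productSpan, Submodule.mem_sup, Submodule.mem_map, LinearMap.mulLeft_apply]
  constructor
  · rintro ⟨a, ha, _, ⟨c, hc, rfl⟩, rfl⟩
    exact ⟨a, ha, c, hc, rfl⟩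
  · rintro ⟨a, ha, c, hc, rfl⟩
    exact ⟨a, ha, _, ⟨c, hc, rfl⟩, rfl⟩

theorem one_mem_productSpan (l : List E) : (1 : Cl (euc E)) ∈ productSpan l := by
  induction l with
  | nil => exact Submodule.subset_span rfl
  | cons e l ih => exact Submodule.mem_sup_left ih

/-- Moving `v` past each factor orthogonal to it costs a sign, so in total the grading involution.
-/
theorem vec_mul_of_mem_productSpan {v : E} {l : List E} (h : ∀ e ∈ l, inner ℝ v e = 0)
    {a : Cl (euc E)} (ha : a ∈ productSpan l) :
    vec (euc E) v * a = involute a * vec (euc E) v := by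
  induction l generalizing a with
  | nil =>
    obtain ⟨r, rfl⟩ := Submodule.mem_span_singleton.mp ha
    simp
  | cons e l ih =>
    obtain ⟨a, ha', c, hc, rfl⟩ := mem_productSpan_cons.mp ha
    have h' : ∀ e ∈ l, inner ℝ v e = 0 := fun f hf => h f (List.mem_cons_of_mem _ hf)
    rw [mul_add, map_add, add_mul, ih h' ha', map_mul, involute_ι, ← mul_assoc,
      vec_mul_of_orthogonal (h e List.mem_cons_self), neg_mul, mul_assoc, ih h' hc, neg_mul, neg_mul,
      mul_assoc]

theorem vec_mul_mem_productSpan {v : E} {l : List E} (hl : l.Pairwise fun e f => inner ℝ e f = 0)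
    (hv : v ∈ l) {a : Cl (euc E)} (ha : a ∈ productSpan l) :
    vec (euc E) v * a ∈ productSpan l := by
  induction l generalizing a with
  | nil => simp at hv
  | cons e l ih =>
    obtain ⟨a, ha', c, hc, rfl⟩ := mem_productSpan_cons.mp ha
    rw [List.pairwise_cons] at hl
    rcases List.mem_cons.mp hv with rfl | hv
    · refine mem_productSpan_cons.mpr ⟨inner ℝ v v • c, Submodule.smul_mem _ _ hc, a, ha', ?_⟩
      rw [mul_add, ← mul_assoc, vec_mul_self, Algebra.smul_def, add_comm]
    · refine mem_productSpan_cons.mpr ⟨_, ih hl.2 hv ha', -(vec (euc E) v * c),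
        Submodule.neg_mem _ (ih hl.2 hv hc), ?_⟩
      rw [mul_add, ← mul_assoc, mul_neg, ← mul_assoc, ← neg_mul,
        vec_mul_of_orthogonal ((real_inner_comm _ _).trans (hl.1 v hv))]

theorem productSpan_basis_eq_top {κ : Type*} [Fintype κ] (u : OrthonormalBasis κ ℝ E) :
    productSpan (Finset.univ.toList.map u) = ⊤ := by
  have hl : (Finset.univ.toList.map u).Pairwise fun e f => inner ℝ e f = 0 := by
    refine List.Pairwise.map _ (fun i j hij => u.orthonormal.2 hij) (Finset.nodup_toList _)
  refine eq_top_iff.mpr fun x _ => ?_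
  induction x using left_induction with
  | algebraMap r =>
    rw [Algebra.algebraMap_eq_smul_one]
    exact Submodule.smul_mem _ _ (one_mem_productSpan _)
  | add x y hx hy => exact Submodule.add_mem _ (hx trivial) (hy trivial)
  | ι_mul x m hx =>
    have hm : m = ∑ i, inner ℝ (u i) m • u i := (u.sum_repr' m).symm
    rw [hm, map_sum, Finset.sum_mul]
    refine Submodule.sum_mem _ fun i _ => ?_
    rw [map_smul, smul_mul_assoc]
    exact Submodule.smul_mem _ _ (vec_mul_mem_productSpan hl
      (List.mem_map.mpr ⟨i, Finset.mem_toList.mpr (Finset.mem_univ i), rfl⟩) (hx trivial))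

/-- For a unit vector `e` and `x = a + e c` with `a`, `c` free of `e`, the twisted conjugation `x ↦
e · involute x · e` gives `a - e c`. Hence a graded ideal containing `x` contains `a` and `c`. One
of them is non-zero and involves fewer vectors, so descent ends at a non-zero scalar. -/
theorem one_mem_of_graded_ideal {I : Submodule ℝ (Cl (euc E))} (hI : ∀ x ∈ I, involute x ∈ I)
    (hleft : ∀ (v : E), ∀ x ∈ I, vec (euc E) v * x ∈ I)
    (hright : ∀ (v : E), ∀ x ∈ I, x * vec (euc E) v ∈ I) {l : List E}
    (hl : l.Pairwise fun e f => inner ℝ e f = 0) (hu : ∀ e ∈ l, inner ℝ e e = (1 : ℝ))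
    {x : Cl (euc E)} (hx : x ∈ I) (hx' : x ∈ productSpan l) (h0 : x ≠ 0) : 1 ∈ I := by
  induction l generalizing x with
  | nil =>
    obtain ⟨r, rfl⟩ := Submodule.mem_span_singleton.mp hx'
    have hr : r ≠ 0 := by rintro rfl; simp at h0
    simpa [smul_smul, hr] using Submodule.smul_mem I r⁻¹ hx
  | cons e l ih =>
    obtain ⟨a, ha, c, hc, rfl⟩ := mem_productSpan_cons.mp hx'
    rw [List.pairwise_cons] at hl
    have he : vec (euc E) e * vec (euc E) e = 1 := by
      rw [vec_mul_self, hu e List.mem_cons_self, map_one]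
    have hal := vec_mul_of_mem_productSpan hl.1 ha
    have hcl := vec_mul_of_mem_productSpan hl.1 hc
    have hconj : vec (euc E) e * involute (a + vec (euc E) e * c) * vec (euc E) e =
        a - vec (euc E) e * c := by
      rw [map_add, map_mul, involute_ι, mul_assoc, add_mul, ← hal, mul_assoc, ← hcl, mul_add,
        ← mul_assoc, he, one_mul, neg_mul, mul_neg, ← mul_assoc (vec (euc E) e), he, one_mul,
        sub_eq_add_neg]
    have hy : a - vec (euc E) e * c ∈ I := hconj ▸ hright e _ (hleft e _ (hI _ hx))
    have haI : a ∈ I := by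
      have := Submodule.smul_mem I (1 / 2 : ℝ) (Submodule.add_mem I hx hy)
      convert this using 1
      module
    have hcI : c ∈ I := by
      have h1 := hleft e _ ((Submodule.add_mem_iff_right I haI).mp hx)
      rwa [← mul_assoc, he, one_mul] at h1
    have hu' : ∀ e ∈ l, inner ℝ e e = (1 : ℝ) := fun f hf => hu f (List.mem_cons_of_mem _ hf)
    by_cases ha0 : a = 0
    · refine ih hl.2 hu' hcI hc ?_
      rintro rfl
      simp [ha0] at h0
    · exact ih hl.2 hu' haI ha ha0

theorem graded_ideal_eq_bot_or_one_mem [FiniteDimensional ℝ E] (I : Submodule ℝ (Cl (euc E)))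
    (hI : ∀ x ∈ I, involute x ∈ I) (hleft : ∀ (v : E), ∀ x ∈ I, vec (euc E) v * x ∈ I)
    (hright : ∀ (v : E), ∀ x ∈ I, x * vec (euc E) v ∈ I) : I = ⊥ ∨ 1 ∈ I := by
  by_cases h : I = ⊥
  · exact .inl h
  · obtain ⟨x, hx, h0⟩ := Submodule.exists_mem_ne_zero_of_ne_bot h
    let u := stdOrthonormalBasis ℝ E
    refine .inr (one_mem_of_graded_ideal hI hleft hright (l := Finset.univ.toList.map u) ?_ ?_ hx
      (productSpan_basis_eq_top u ▸ Submodule.mem_top) h0)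
    · exact List.Pairwise.map _ (fun i j hij => u.orthonormal.2 hij) (Finset.nodup_toList _)
    · intro e he
      obtain ⟨i, -, rfl⟩ := List.mem_map.mp he
      rw [real_inner_self_eq_norm_sq, u.orthonormal.1 i, one_pow]

variable {A : Type*} [Ring A] [Algebra ℝ A]

/-- The image of `Cl(E)` under an algebra homomorphism either is isomorphic to `Cl(E)`, or is
already the image of the even part, and then the kernel has no non-zero odd elements. -/
theorem injective_or_even_lift [FiniteDimensional ℝ E] (φ : Cl (euc E) →ₐ[ℝ] A) [Nontrivial A] :
    (∀ x, φ x = 0 → x = 0) ∨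
      (∀ x, φ x = 0 → involute x = -x → x = 0) ∧ ∀ c, ∃ d, involute d = d ∧ φ d = φ c := by
  let J : Submodule ℝ (Cl (euc E)) := LinearMap.ker φ.toLinearMap
  let K : Submodule ℝ (Cl (euc E)) := LinearMap.ker (φ.toLinearMap ∘ₗ involute.toLinearMap)
  have hJ : ∀ x, x ∈ J ↔ φ x = 0 := fun x => Iff.rfl
  have hK : ∀ x, x ∈ K ↔ φ (involute x) = 0 := fun x => Iff.rfl
  -- The kernel `J` and its image `K` under the involution are exchanged by the involution, so `J ⊓
  -- K` and `J ⊔ K` are graded ideals to which the dichotomy applies; `1 ∉ J` because `A` is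
  -- non-trivial.
  have hinf : J ⊓ K = ⊥ := by
    refine (graded_ideal_eq_bot_or_one_mem (J ⊓ K) ?_ ?_ ?_).resolve_right ?_
    · rintro x ⟨h1, h2⟩
      exact ⟨h2, by simpa [hK] using (hJ x).mp h1⟩
    · rintro v x ⟨h1, h2⟩
      replace h1 := (hJ x).mp h1
      replace h2 := (hK x).mp h2
      exact ⟨by simp [hJ, h1], by simp [hK, h2]⟩
    · rintro v x ⟨h1, h2⟩
      replace h1 := (hJ x).mp h1
      replace h2 := (hK x).mp h2
      exact ⟨by simp [hJ, h1], by simp [hK, h2]⟩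
    · rintro ⟨h1, -⟩
      simp [hJ] at h1
  have hodd : ∀ x, φ x = 0 → involute x = -x → x = 0 := by
    intro x hx hx'
    have : x ∈ J ⊓ K := ⟨hx, (hK x).mpr (by rw [hx', map_neg, hx, neg_zero])⟩
    simpa [hinf] using this
  have hsup : J ⊔ K = ⊥ ∨ 1 ∈ J ⊔ K := by
    refine graded_ideal_eq_bot_or_one_mem (J ⊔ K) ?_ ?_ ?_
    · intro x hx
      obtain ⟨j, hj, k, hk, rfl⟩ := Submodule.mem_sup.mp hx
      rw [hJ] at hj
      rw [hK] at hk
      rw [map_add, add_comm]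
      refine Submodule.add_mem_sup hk ?_
      rw [hK, involute_involute, hj]
    · intro v x hx
      obtain ⟨j, hj, k, hk, rfl⟩ := Submodule.mem_sup.mp hx
      rw [hJ] at hj
      rw [hK] at hk
      rw [mul_add]
      exact Submodule.add_mem_sup (by simp [hJ, hj]) (by simp [hK, hk])
    · intro v x hx
      obtain ⟨j, hj, k, hk, rfl⟩ := Submodule.mem_sup.mp hx
      rw [hJ] at hj
      rw [hK] at hk
      rw [add_mul]
      exact Submodule.add_mem_sup (by simp [hJ, hj]) (by simp [hK, hk])
  rcases hsup with h | h
  · left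
    intro x hx
    have : x ∈ J ⊔ K := Submodule.mem_sup_left hx
    simpa [h] using this
  · refine .inr ⟨hodd, fun c => ?_⟩
    obtain ⟨j, hj, k, hk, hjk⟩ := Submodule.mem_sup.mp h
    rw [hJ] at hj
    rw [hK] at hk
    have hφk : φ k = 1 := by rw [← map_one φ, ← hjk, map_add, hj, zero_add]
    -- The element `k` satisfies `φ k = 1` and `φ (involute k) = 0`, so symmetrizing `c * k` makes
    -- it even without changing the image `φ c`.
    refine ⟨c * k + involute (c * k), by rw [map_add, involute_involute, add_comm], ?_⟩
    rw [map_add, map_mul, map_mul involute, map_mul, hφk, hk, mul_zero, mul_one, add_zero]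

theorem sq_mulLeft_sub_mulRight (c₁ c₂ x : Cl (euc E)) :
    ((LinearMap.mulLeft ℝ c₁ - LinearMap.mulRight ℝ c₂) ^ 2) x =
      c₁ * (c₁ * x - x * c₂) - (c₁ * x - x * c₂) * c₂ := by
  simp [sq]

/-- Solutions of the quadratic Clifford equation in a quotient of `Cl(E)` lift to `Cl(E)`. -/
theorem exists_quadraticClifford_lift [FiniteDimensional ℝ E] (b : CWForm E)
    (φ : Cl (euc E) →ₐ[ℝ] A) [Nontrivial A] (c₁ c₂ : Cl (euc E))
    (h : ∀ e, φ (c₁ * (c₁ * vec _ e - vec _ e * c₂) - (c₁ * vec _ e - vec _ e * c₂) * c₂) =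
      -φ (vec _ (b.B e))) :
    ∃ d₁ d₂, φ d₁ = φ c₁ ∧ φ d₂ = φ c₂ ∧ QuadraticClifford b d₁ d₂ := by
  suffices H : ∃ d₁ d₂, φ d₁ = φ c₁ ∧ φ d₂ = φ c₂ ∧ ∀ e,
      ((LinearMap.mulLeft ℝ d₁ - LinearMap.mulRight ℝ d₂) ^ 2) (vec _ e) = -vec _ (b.B e) by
    obtain ⟨d₁, d₂, h1, h2, h3⟩ := H
    exact ⟨d₁, d₂, h1, h2, fun e => ⟨-b.B e, by rw [h3, map_neg]⟩, h3⟩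
  simp only [sq_mulLeft_sub_mulRight]
  rcases injective_or_even_lift φ with hφ | ⟨hφ, hlift⟩
  · refine ⟨c₁, c₂, rfl, rfl, fun e => ?_⟩
    rw [← sub_eq_zero]
    refine hφ _ ?_
    rw [map_sub, h, map_neg, sub_self]
  -- With even lifts, both sides of the equation are odd on a vector, and the kernel has no non-zero
  -- odd elements.
  · obtain ⟨d₁, h1, h1'⟩ := hlift c₁
    obtain ⟨d₂, h2, h2'⟩ := hlift c₂
    refine ⟨d₁, d₂, h1', h2', fun e => ?_⟩
    rw [← sub_eq_zero]
    refine hφ _ ?_ ?_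
    · have := h e
      simp only [map_sub, map_mul, map_neg] at this ⊢
      rw [h1', h2', this, sub_self]
    · simp only [map_sub, map_mul, map_neg, involute_ι, h1, h2]
      noncomm_ring

end CliffordStructure

/-! ### Forms which are skew-symmetric after Clifford multiplication by a vector -/

section Forms

variable {E : Type*} [NormedAddCommGroup E] [InnerProductSpace ℝ E]
variable {V : Type*} [AddCommGroup V] [Module ℝ V] {ρ : Cl (euc E) →ₐ[ℝ] Module.End ℝ V}

theorem vec_vec_apply (ρ : Cl (euc E) →ₐ[ℝ] Module.End ℝ V) (e : E) (s : V) :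
    ρ (vec _ e) (ρ (vec _ e) s) = (inner ℝ e e : ℝ) • s := by
  rw [← Module.End.mul_apply, ← map_mul, vec_mul_self, AlgHom.commutes]
  rfl

theorem vec_injective {e : E} (he : e ≠ 0) {s : V} (h : ρ (vec _ e) s = 0) : s = 0 := by
  have h1 := vec_vec_apply ρ e s
  rw [h, map_zero] at h1
  exact (smul_eq_zero.mp h1.symm).resolve_left (inner_self_ne_zero.mpr he)

/-- Moving two vectors across `Γ` reverses their order and contributes `τ² = 1`, so commutators of
vectors are skew for `Γ`. -/
theorem invariant_of_type {Γ : LinearMap.BilinForm ℝ V} {τ : ℤˣ}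
    (h : ∀ (v : E) (s t : V), Γ (ρ (vec _ v) s) t = (τ : ℤ) * Γ s (ρ (vec _ v) t))
    (v w : E) (s t : V) :
    Γ (ρ (soCl (euc E) v w) s) t + Γ s (ρ (soCl (euc E) v w) t) = 0 := by
  have hτ : (((τ : ℤ) : ℝ)) * ((τ : ℤ) : ℝ) = 1 := by
    rw [← Int.cast_mul, ← Units.val_mul, Int.units_mul_self]; simp
  have h2 : ∀ v w : E, Γ (ρ (vec _ v) (ρ (vec _ w) s)) t = Γ s (ρ (vec _ w) (ρ (vec _ v) t)) := by
    intro v w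
    rw [h, h, ← mul_assoc, hτ, one_mul]
  simp only [soCl, map_smul, map_sub, map_mul, LinearMap.smul_apply, LinearMap.sub_apply,
    Module.End.mul_apply, h2, smul_eq_mul]
  ring

/-- The property `Γ(v s, t) = -Γ(v t, s)` of bilinear forms on a Clifford module. -/
def IsVecSkew (ρ : Cl (euc E) →ₐ[ℝ] Module.End ℝ V) (Γ : LinearMap.BilinForm ℝ V) : Prop :=
  ∀ (v : E) (s t : V), Γ (ρ (vec _ v) s) t = -Γ (ρ (vec _ v) t) s

/-- Substituting `v t`, `v s` for `s`, `t` and cancelling the scalar `v²` moves the vector to the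
other argument. This lets the symmetric and skew parts of `Γ` be treated separately. -/
theorem IsVecSkew.flip {Γ : LinearMap.BilinForm ℝ V} (h : IsVecSkew ρ Γ) :
    IsVecSkew ρ (LinearMap.flip Γ) := by
  intro v s t
  simp only [LinearMap.flip_apply]
  by_cases hv : v = 0
  · simp [hv]
  have h0 : (inner ℝ v v : ℝ) ≠ 0 := inner_self_ne_zero.mpr hv
  have h1 := h v (ρ (vec _ v) t) (ρ (vec _ v) s)
  rw [vec_vec_apply, vec_vec_apply] at h1
  simp only [map_smul, LinearMap.smul_apply, smul_eq_mul, ← mul_neg] at h1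
  exact mul_left_cancel₀ h0 h1

theorem isVecSkew_of_mem {Sm Sp : Submodule ℝ V} {Γ : LinearMap.BilinForm ℝ V}
    (h : Γ ∈ bilTauSigmaNeg ρ Sm Sp) : IsVecSkew ρ Γ := by
  intro v s t
  induction h using Submodule.span_induction with
  | mem Γ h =>
    obtain ⟨τ, σ, hτσ, hΓ⟩ := h
    rw [hΓ.type, hΓ.symmetry, ← mul_assoc, ← Int.cast_mul, ← Units.val_mul, hτσ]
    simp
  | zero => simp
  | add Γ Γ' _ _ h h' => simp only [LinearMap.add_apply, h, h']; ring
  | smul r Γ _ h => simp only [LinearMap.smul_apply, h, smul_neg]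

/-- Only the isotropy condition on semi-spinors can fail. Vectors exchange the projections to `Sm`
and `Sp`, so the block-diagonal and off-diagonal parts of `Γ` each keep `τ` and `σ`; each satisfies
one of the two isotropy alternatives. -/
theorem mem_bilTauSigmaNeg_of_type {Sm Sp : Submodule ℝ V}
    (hS : ¬ SoIrreducible ρ (⊤ : Submodule ℝ V) → IsSemispinorSplitting ρ Sm Sp)
    {Γ : LinearMap.BilinForm ℝ V} {τ σ : ℤˣ} (hτσ : τ * σ = -1)
    (htype : ∀ (v : E) (s t : V), Γ (ρ (vec _ v) s) t = (τ : ℤ) * Γ s (ρ (vec _ v) t))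
    (hsymm : ∀ s t : V, Γ s t = (σ : ℤ) * Γ t s) : Γ ∈ bilTauSigmaNeg ρ Sm Sp := by
  by_cases hirr : SoIrreducible ρ (⊤ : Submodule ℝ V)
  · exact Submodule.subset_span
      ⟨τ, σ, hτσ, invariant_of_type htype, htype, hsymm, fun h => absurd hirr h⟩
  have hsp := hS hirr
  let P : V →ₗ[ℝ] V := Sm.projection Sp hsp.compl
  let R : V →ₗ[ℝ] V := Sp.projection Sm hsp.compl.symm
  have hPm : ∀ s, P s ∈ Sm := fun s => Submodule.projection_apply_mem hsp.compl s
  have hRp : ∀ s, R s ∈ Sp := fun s => Submodule.projection_apply_mem hsp.compl.symm s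
  have hPR : ∀ s, P s + R s = s := fun s =>
    Submodule.projection_add_projection_eq_self hsp.compl s
  have hPSm : ∀ s ∈ Sm, P s = s := fun s hs => Submodule.projection_apply_left hsp.compl ⟨s, hs⟩
  have hRSp : ∀ s ∈ Sp, R s = s := fun s hs => Submodule.projection_apply_left hsp.compl.symm ⟨s, hs⟩
  have hRSm : ∀ s ∈ Sm, R s = 0 := fun s hs => by
    have := hPR s
    rwa [hPSm s hs, add_eq_left] at this
  have hPSp : ∀ s ∈ Sp, P s = 0 := fun s hs => by
    have := hPR s
    rwa [hRSp s hs, add_eq_right] at this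
  have hPv : ∀ v s, P (ρ (vec _ v) s) = ρ (vec _ v) (R s) := by
    intro v s
    conv_lhs => rw [← hPR s]
    rw [map_add, map_add, hPSp _ (hsp.odd_minus v _ (hPm s)), zero_add,
      hPSm _ (hsp.odd_plus v _ (hRp s))]
  have hRv : ∀ v s, R (ρ (vec _ v) s) = ρ (vec _ v) (P s) := by
    intro v s
    conv_lhs => rw [← hPR s]
    rw [map_add, map_add, hRSp _ (hsp.odd_minus v _ (hPm s)),
      hRSm _ (hsp.odd_plus v _ (hRp s)), add_zero]
  have hdiag : Γ.compl₁₂ P P + Γ.compl₁₂ R R ∈ bilTauSigmaNeg ρ Sm Sp := by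
    have ht : ∀ (v : E) (s t : V), (Γ.compl₁₂ P P + Γ.compl₁₂ R R) (ρ (vec _ v) s) t =
        (τ : ℤ) * (Γ.compl₁₂ P P + Γ.compl₁₂ R R) s (ρ (vec _ v) t) := by
      intro v s t
      simp only [LinearMap.add_apply, LinearMap.compl₁₂_apply, hPv, hRv, htype]
      ring
    refine Submodule.subset_span ⟨τ, σ, hτσ, invariant_of_type ht, ht, ?_, fun _ => .inl ?_⟩
    · intro s t
      simp only [LinearMap.add_apply, LinearMap.compl₁₂_apply]
      rw [hsymm (P s), hsymm (R s)]
      ring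
    · intro s hs t ht
      simp [hPSp t ht, hRSm s hs]
  have hoff : Γ.compl₁₂ P R + Γ.compl₁₂ R P ∈ bilTauSigmaNeg ρ Sm Sp := by
    have ht : ∀ (v : E) (s t : V), (Γ.compl₁₂ P R + Γ.compl₁₂ R P) (ρ (vec _ v) s) t =
        (τ : ℤ) * (Γ.compl₁₂ P R + Γ.compl₁₂ R P) s (ρ (vec _ v) t) := by
      intro v s t
      simp only [LinearMap.add_apply, LinearMap.compl₁₂_apply, hPv, hRv, htype]
      ring
    refine Submodule.subset_span
      ⟨τ, σ, hτσ, invariant_of_type ht, ht, ?_, fun _ => .inr ⟨?_, ?_⟩⟩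
    · intro s t
      simp only [LinearMap.add_apply, LinearMap.compl₁₂_apply]
      rw [hsymm (P s), hsymm (R s)]
      ring
    · intro s hs t ht
      simp [hRSm t ht, hRSm s hs]
    · intro s hs t ht
      simp [hPSp t ht, hPSp s hs]
  have hsum : Γ = (Γ.compl₁₂ P P + Γ.compl₁₂ R R) + (Γ.compl₁₂ P R + Γ.compl₁₂ R P) := by
    refine LinearMap.ext₂ fun s t => ?_
    conv_lhs => rw [← hPR s, ← hPR t]
    simp only [LinearMap.add_apply, LinearMap.compl₁₂_apply, map_add]
    ring
  rw [hsum]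
  exact Submodule.add_mem _ hdiag hoff

theorem IsVecSkew.mem_bilTauSigmaNeg {Sm Sp : Submodule ℝ V}
    (hS : ¬ SoIrreducible ρ (⊤ : Submodule ℝ V) → IsSemispinorSplitting ρ Sm Sp)
    {Γ : LinearMap.BilinForm ℝ V} (h : IsVecSkew ρ Γ) : Γ ∈ bilTauSigmaNeg ρ Sm Sp := by
  have hf := h.flip
  simp only [IsVecSkew, LinearMap.flip_apply] at hf
  have hsum : Γ = (1 / 2 : ℝ) • (Γ + LinearMap.flip Γ) + (1 / 2 : ℝ) • (Γ - LinearMap.flip Γ) := by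
    module
  rw [hsum]
  refine Submodule.add_mem _ (Submodule.smul_mem _ _ ?_) (Submodule.smul_mem _ _ ?_)
  · refine mem_bilTauSigmaNeg_of_type hS (τ := -1) (σ := 1) (by simp) (fun v s t => ?_)
      fun s t => ?_
    · simp only [LinearMap.add_apply, LinearMap.flip_apply, Units.val_neg, Units.val_one,
        Int.cast_neg, Int.cast_one]
      rw [h v s t, hf v s t]
      ring
    · simp only [LinearMap.add_apply, LinearMap.flip_apply, Units.val_one, Int.cast_one]
      ring
  · refine mem_bilTauSigmaNeg_of_type hS (τ := 1) (σ := -1) (by simp) (fun v s t => ?_)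
      fun s t => ?_
    · simp only [LinearMap.sub_apply, LinearMap.flip_apply, Units.val_one, Int.cast_one]
      rw [h v s t, hf v s t]
      ring
    · simp only [LinearMap.sub_apply, LinearMap.flip_apply, Units.val_neg, Units.val_one,
        Int.cast_neg, Int.cast_one]
      ring

end Forms

/-! ### Block matrices in the image of the spin representation -/

section Blocks

variable {E : Type*} [NormedAddCommGroup E] [InnerProductSpace ℝ E]
variable {V : Type*} [AddCommGroup V] [Module ℝ V]

theorem block_mul (x y z t x' y' z' t' : Module.End ℝ V) :
    block x y z t * block x' y' z' t' =
      block (x * x' + y * z') (x * y' + y * t') (z * x' + t * z') (z * y' + t * t') := by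
  refine LinearMap.ext fun Q => Prod.ext ?_ ?_ <;>
    simp only [Module.End.mul_apply, block_apply, map_add, LinearMap.add_apply] <;> abel

theorem block_add (x y z t x' y' z' t' : Module.End ℝ V) :
    block x y z t + block x' y' z' t' = block (x + x') (y + y') (z + z') (t + t') := by
  refine LinearMap.ext fun Q => Prod.ext ?_ ?_ <;>
    simp only [block_apply, LinearMap.add_apply, Prod.fst_add, Prod.snd_add] <;> abel

theorem block_sub (x y z t x' y' z' t' : Module.End ℝ V) :
    block x y z t - block x' y' z' t' = block (x - x') (y - y') (z - z') (t - t') := by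
  refine LinearMap.ext fun Q => Prod.ext ?_ ?_ <;>
    simp only [block_apply, LinearMap.sub_apply, Prod.fst_sub, Prod.snd_sub] <;> abel

theorem smul_block (r : ℝ) (x y z t : Module.End ℝ V) :
    r • block x y z t = block (r • x) (r • y) (r • z) (r • t) := by
  refine LinearMap.ext fun Q => Prod.ext ?_ ?_ <;> simp [block_apply]

theorem block_inj {x y z t x' y' z' t' : Module.End ℝ V} :
    block x y z t = block x' y' z' t' ↔ x = x' ∧ y = y' ∧ z = z' ∧ t = t' := by
  refine ⟨fun h => ?_, by rintro ⟨rfl, rfl, rfl, rfl⟩; rfl⟩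
  have h1 : ∀ s : V, _ := fun s => LinearMap.congr_fun h (s, 0)
  have h2 : ∀ s : V, _ := fun s => LinearMap.congr_fun h (0, s)
  simp only [block_apply, map_zero, add_zero, zero_add, Prod.mk.injEq] at h1 h2
  exact ⟨LinearMap.ext fun s => (h1 s).1, LinearMap.ext fun s => (h2 s).1,
    LinearMap.ext fun s => (h1 s).2, LinearMap.ext fun s => (h2 s).2⟩

theorem block_scalar (r : ℝ) : block (r • 1) 0 0 (r • 1) = r • (1 : Module.End ℝ (V × V)) := by
  refine LinearMap.ext fun Q => Prod.ext ?_ ?_ <;> simp [block_apply]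

variable (ρ : Cl (euc E) →ₐ[ℝ] Module.End ℝ V)

theorem spinRep_vec (v : Mink E) : spinRep ρ (vec (mink E) v) = minkAct ρ v := by
  simp [spinRep]

theorem minkAct_apply (v : Mink E) : minkAct ρ v = block (-ρ (vec _ v.1))
    ((2 * √2 * v.2.1) • 1) ((-(1 / √2) * v.2.2) • 1) (ρ (vec _ v.1)) := rfl

theorem exists_block_eq_spinRep (c : Cl (mink E)) :
    ∃ x y z t, spinRep ρ c = block (ρ x) (ρ y) (ρ z) (ρ t) := by
  induction c using CliffordAlgebra.induction with
  | algebraMap r =>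
    refine ⟨algebraMap ℝ _ r, 0, 0, algebraMap ℝ _ r, ?_⟩
    rw [AlgHom.commutes, AlgHom.commutes, map_zero, Algebra.algebraMap_eq_smul_one,
      Algebra.algebraMap_eq_smul_one, block_scalar]
  | ι v =>
    refine ⟨-vec _ v.1, (2 * √2 * v.2.1) • 1, (-(1 / √2) * v.2.2) • 1, vec _ v.1, ?_⟩
    rw [spinRep_vec, minkAct_apply, map_neg, map_smul, map_smul, map_one]
  | mul a c ha hc =>
    obtain ⟨x, y, z, t, h⟩ := ha
    obtain ⟨x', y', z', t', h'⟩ := hc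
    refine ⟨x * x' + y * z', x * y' + y * t', z * x' + t * z', z * y' + t * t', ?_⟩
    rw [map_mul, h, h', block_mul]
    simp only [map_add, map_mul]
  | add a c ha hc =>
    obtain ⟨x, y, z, t, h⟩ := ha
    obtain ⟨x', y', z', t', h'⟩ := hc
    refine ⟨x + x', y + y', z + z', t + t', ?_⟩
    rw [map_add, h, h', block_add]
    simp only [map_add]

/-- Up to scalars `p` and `q` act as the two off-diagonal matrix units. Their product is the upper
left idempotent, which cuts the corner `ρ(Cl(E))` out of the action of `E`; moving this corner
around fills all four blocks. -/
theorem block_mem_range_spinRep (x y z t : Cl (euc E)) :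
    block (ρ x) (ρ y) (ρ z) (ρ t) ∈ (spinRep ρ).range := by
  have h2 : √2 ≠ 0 := by positivity
  have hmink : ∀ v, minkAct ρ v ∈ (spinRep ρ).range := fun v => ⟨_, spinRep_vec ρ v⟩
  have hN : block (0 : Module.End ℝ V) 1 0 0 ∈ (spinRep ρ).range := by
    have := Subalgebra.smul_mem _ (hmink (0, 1, 0)) (1 / (2 * √2))
    rw [minkAct_apply, smul_block, smul_smul, show 1 / (2 * √2) * (2 * √2 * 1) = 1 by field_simp]
      at this
    simpa [smul_smul, h2] using this
  have hN' : block (0 : Module.End ℝ V) 0 1 0 ∈ (spinRep ρ).range := by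
    have := Subalgebra.smul_mem _ (hmink (0, 0, 1)) (-√2)
    rw [minkAct_apply, smul_block] at this
    simpa [smul_smul, h2] using this
  have h1 : block (1 : Module.End ℝ V) 0 0 0 ∈ (spinRep ρ).range := by
    have := Subalgebra.mul_mem _ hN hN'
    rw [block_mul] at this
    simpa using this
  have hx : ∀ c, block (ρ c) 0 0 0 ∈ (spinRep ρ).range := by
    intro c
    induction c using CliffordAlgebra.induction with
    | algebraMap r =>
      have := Subalgebra.smul_mem _ h1 r
      rw [smul_block] at this
      simpa [Algebra.algebraMap_eq_smul_one] using this
    | ι v =>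
      have := Subalgebra.neg_mem _ (Subalgebra.mul_mem _ (hmink (v, 0, 0)) h1)
      rw [minkAct_apply, block_mul, ← neg_one_smul ℝ, smul_block] at this
      simpa using this
    | mul a c ha hc =>
      have := Subalgebra.mul_mem _ ha hc
      rw [block_mul] at this
      simpa using this
    | add a c ha hc =>
      have := Subalgebra.add_mem _ ha hc
      rw [block_add] at this
      simpa using this
  have key : block (ρ x) (ρ y) (ρ z) (ρ t) = block (ρ x) 0 0 0 + block (ρ y) 0 0 0 * block 0 1 0 0
      + block 0 0 1 0 * block (ρ z) 0 0 0
      + block 0 0 1 0 * block (ρ t) 0 0 0 * block 0 1 0 0 := by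
    simp [block_mul, block_add]
  rw [key]
  exact add_mem (add_mem (add_mem (hx x) (mul_mem (hx y) hN)) (mul_mem hN' (hx z)))
    (mul_mem (mul_mem hN' (hx t)) hN)

/-- As `p` and `B e` anticommute, the commutator over 4 is half their product, and half of the `2√2`
in the action of `p` is `√2`. -/
theorem isotropySpin_flat [FiniteDimensional ℝ E] (b : CWForm E) (ξ : Module.Dual ℝ E) :
    isotropySpin b ρ ξ = √2 • block 0 (ρ (vec _ (b.B ((flat E).symm ξ)))) 0 0 := by
  rw [isotropySpin, soCl, map_smul, map_sub, map_mul, map_mul, spinRep_vec, spinRep_vec,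
    minkAct_apply, minkAct_apply, block_mul, block_mul, sub_eq_add_neg, ← neg_one_smul ℝ (block _ _ _ _),
    smul_block, block_add, smul_block, smul_block, block_inj]
  refine ⟨by simp, ?_, by simp, by simp⟩
  simp
  module

end Blocks

/-! ### Lie superalgebras from representations of Lie algebras -/

section General

variable {A₀ A₁ : Type*}

section

variable [AddCommGroup A₀] [Module ℝ A₀] [AddCommGroup A₁] [Module ℝ A₁]

theorem mem_parityPart_zero {x : A₀ × A₁} : x ∈ parityPart A₀ A₁ 0 ↔ x.2 = 0 := by
  obtain ⟨x, y⟩ := x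
  simp [parityPart, eq_comm]

theorem mem_parityPart_one {x : A₀ × A₁} : x ∈ parityPart A₀ A₁ 1 ↔ x.1 = 0 := by
  obtain ⟨x, y⟩ := x
  simp [parityPart, eq_comm]

end

variable [LieRing A₀] [LieAlgebra ℝ A₀] [AddCommGroup A₁] [Module ℝ A₁]

theorem parity_cases {p : ZMod 2 → Prop} (h0 : p 0) (h1 : p 1) (i : ZMod 2) : p i := by
  fin_cases i
  exacts [h0, h1]

/-- The Lie superalgebra on `A₀ + A₁` defined by a representation of the Lie algebra `A₀` on `A₁`
and an equivariant symmetric bilinear map `A₁ × A₁ → A₀` satisfying the odd Jacobi identity. -/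
def LieSuperalgebraOn.ofRepresentation (act : A₀ →ₗ[ℝ] Module.End ℝ A₁) (P : A₁ →ₗ[ℝ] A₁ →ₗ[ℝ] A₀)
    (hact : ∀ x y Q, act ⁅x, y⁆ Q = act x (act y Q) - act y (act x Q))
    (hsymm : ∀ Q R, P Q R = P R Q)
    (hequiv : ∀ x Q R, ⁅x, P Q R⁆ = P (act x Q) R + P Q (act x R))
    (hodd : ∀ Q R T, act (P Q R) T + act (P R T) Q + act (P T Q) R = 0) :
    LieSuperalgebraOn A₀ A₁ where
  br := LinearMap.mk₂ ℝ (fun x y => (⁅x.1, y.1⁆ + P x.2 y.2, act x.1 y.2 - act y.1 x.2))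
    (by intro x x' y; refine Prod.ext ?_ ?_ <;> simp <;> abel)
    (by intro r x y; refine Prod.ext ?_ ?_ <;> simp [smul_sub])
    (by intro x y y'; refine Prod.ext ?_ ?_ <;> simp <;> abel)
    (by intro r x y; refine Prod.ext ?_ ?_ <;> simp [smul_sub])
  graded := by
    have h11 : (1 : ZMod 2) + 1 = 0 := rfl
    intro i j
    induction i using parity_cases <;> induction j using parity_cases <;>
      simp +contextual [mem_parityPart_zero, mem_parityPart_one, h11]
  skew := by
    intro i j
    induction i using parity_cases <;> induction j using parity_cases <;>
      rintro ⟨x, Q⟩ hx ⟨y, R⟩ hy <;>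
      simp only [mem_parityPart_zero, mem_parityPart_one] at hx hy <;> subst hx hy
    · simp
    · simp
    · simp
    · simp [ZMod.val_one, hsymm Q]
  -- By parity the cases reduce to the Jacobi identity of `A₀`, the representation property,
  -- equivariance of `P` and the cyclic identity `hodd`.
  jacobi := by
    intro i j
    induction i using parity_cases <;> induction j using parity_cases <;>
      rintro ⟨x, Q⟩ hx ⟨y, R⟩ hy ⟨z, T⟩ <;>
      simp only [mem_parityPart_zero, mem_parityPart_one] at hx hy <;> subst hx hy <;>
      refine Prod.ext ?_ ?_
    · simp
    · simp [hact]
    · simp [hequiv]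
    · simp [hact]
      abel
    · simp [hequiv]
    · simp [hact]
      abel
    · simp only [LinearMap.mk₂_apply, ZMod.val_one, zero_lie, zero_add, map_zero,
        LinearMap.zero_apply, zero_sub, map_neg, mul_one, pow_one, neg_smul, one_smul, sub_zero,
        add_zero, Prod.fst_add, Prod.fst_neg]
      rw [← lie_skew, hequiv, hsymm R]
      abel
    · simp only [LinearMap.mk₂_apply, ZMod.val_one, zero_lie, zero_add, map_zero,
        LinearMap.zero_apply, zero_sub, mul_one, pow_one, neg_smul, one_smul, sub_zero,
        Prod.snd_add, Prod.snd_neg, neg_neg]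
      rw [neg_eq_iff_add_eq_zero, hsymm Q T, ← hodd Q R T]
      abel

end General

/-! ### Components of elements of the Cahen-Wallach algebra -/

section Components

variable {E : Type*} [NormedAddCommGroup E] [InnerProductSpace ℝ E] (b : CWForm E)

theorem inDual_fst (ξ : Module.Dual ℝ E) : (inDual b ξ).1 = ξ := rfl
theorem inDual_snd (ξ : Module.Dual ℝ E) : (inDual b ξ).2 = (0 : Mink E) := rfl
theorem inMink_fst (v : Mink E) : (inMink b v).1 = 0 := rfl
theorem inMink_snd (v : Mink E) : (inMink b v).2 = v := rfl
theorem zero_c1 : (0 : CWAlg b).1 = 0 := rfl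
theorem zero_c2 : (0 : CWAlg b).2.1 = 0 := rfl
theorem zero_c3 : (0 : CWAlg b).2.2.1 = 0 := rfl
theorem zero_c4 : (0 : CWAlg b).2.2.2 = 0 := rfl

variable {b}

theorem elP_ne_zero : elP b ≠ 0 := fun h => by
  have : (elP b).2.2.1 = (0 : CWAlg b).2.2.1 := by rw [h]
  exact one_ne_zero (α := ℝ) this

theorem CWAlg.decompose (x : CWAlg b) :
    x = inDual b x.1 + inE b x.2.1 + x.2.2.1 • elP b + x.2.2.2 • elQ b := by
  refine CWAlg.ext b ?_ ?_ ?_ ?_ <;>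
    simp [add_c1, add_c2, add_c3, add_c4, smul_c1, smul_c2, smul_c3, smul_c4, inDual_fst,
      inDual_snd, inMink_fst, inMink_snd, inE, elP, elQ]

end Components

/-! ### The brackets of a superization -/

section Brackets

variable {E : Type*} [NormedAddCommGroup E] [InnerProductSpace ℝ E] [FiniteDimensional ℝ E]
variable {V : Type*} [AddCommGroup V] [Module ℝ V]
variable {b : CWForm E} {ρ : Cl (euc E) →ₐ[ℝ] Module.End ℝ V}

namespace Superization

variable (g : Superization b ρ)

theorem ext_br {g g' : Superization b ρ} (h : g.br = g'.br) : g = g' := by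
  obtain ⟨⟨_, _, _, _⟩, _, _⟩ := g
  obtain ⟨⟨_, _, _, _⟩, _, _⟩ := g'
  subst h
  rfl

theorem br_even_odd (x : CWAlg b) (Q : V × V) : g.br (x, 0) (0, Q) = (0, g.adOdd x Q) := by
  have h := g.graded 0 1 (x, 0) (mem_parityPart_zero.mpr rfl) (0, Q) (mem_parityPart_one.mpr rfl)
  rw [zero_add, mem_parityPart_one] at h
  exact Prod.ext h rfl

theorem br_odd_even (x : CWAlg b) (Q : V × V) : g.br (0, Q) (x, 0) = (0, -g.adOdd x Q) := by
  have h := g.skew 1 0 (0, Q) (mem_parityPart_one.mpr rfl) (x, 0) (mem_parityPart_zero.mpr rfl)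
  rw [h, br_even_odd]
  simp

theorem br_odd_odd (Q R : V × V) : g.br (0, Q) (0, R) = (g.oddBr Q R, 0) := by
  have h := g.graded 1 1 (0, Q) (mem_parityPart_one.mpr rfl) (0, R) (mem_parityPart_one.mpr rfl)
  rw [show (1 : ZMod 2) + 1 = 0 from rfl, mem_parityPart_zero] at h
  exact Prod.ext rfl h

theorem br_mk (x y : CWAlg b) (Q R : V × V) :
    g.br (x, Q) (y, R) = (⁅x, y⁆ + g.oddBr Q R, g.adOdd x R - g.adOdd y Q) := by
  have h : ∀ (z : CWAlg b) (T : V × V), (z, T) = (z, 0) + (0, T) := by simp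
  rw [h x Q, h y R, map_add, map_add, LinearMap.add_apply, LinearMap.add_apply, g.even_part,
    br_even_odd, br_odd_even, br_odd_odd]
  refine Prod.ext ?_ ?_ <;> simp [sub_eq_add_neg, add_comm]

/-- The bracket of odd elements as a bilinear map. -/
def oddBracket : (V × V) →ₗ[ℝ] (V × V) →ₗ[ℝ] CWAlg b :=
  (g.br.compl₁₂ (LinearMap.inr ℝ (CWAlg b) (V × V)) (LinearMap.inr ℝ (CWAlg b) (V × V))).compr₂
    (LinearMap.fst ℝ (CWAlg b) (V × V))

theorem oddBracket_apply (Q R : V × V) : g.oddBracket Q R = g.oddBr Q R := rfl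

theorem oddBr_comm (Q R : V × V) : g.oddBr Q R = g.oddBr R Q := by
  have h := g.skew 1 1 (0, Q) (mem_parityPart_one.mpr rfl) (0, R) (mem_parityPart_one.mpr rfl)
  rw [br_odd_odd, br_odd_odd] at h
  simpa [ZMod.val_one] using h

theorem oddBr_polarize (Q R : V × V) :
    (2 : ℝ) • g.oddBr Q R = g.oddBr (Q + R) (Q + R) - g.oddBr Q Q - g.oddBr R R := by
  rw [← oddBracket_apply, ← oddBracket_apply, ← oddBracket_apply, ← oddBracket_apply, map_add,
    map_add, LinearMap.add_apply, LinearMap.add_apply, oddBracket_apply g R Q, oddBr_comm,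
    oddBracket_apply g Q R]
  module

/-- The adjoint action on the odd part as a linear map. -/
def adOddLin : CWAlg b →ₗ[ℝ] Module.End ℝ (V × V) where
  toFun := g.adOdd
  map_add' x y := by
    refine LinearMap.ext fun Q => ?_
    have h : ((x + y, 0) : CWAlg b × (V × V)) = (x, 0) + (y, 0) := by simp
    change (g.br (x + y, 0) (0, Q)).2 = (g.br (x, 0) (0, Q)).2 + (g.br (y, 0) (0, Q)).2
    rw [h, map_add, LinearMap.add_apply, Prod.snd_add]
  map_smul' r x := by
    refine LinearMap.ext fun Q => ?_
    have h : ((r • x, 0) : CWAlg b × (V × V)) = r • (x, 0) := by simp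
    change (g.br (r • x, 0) (0, Q)).2 = r • (g.br (x, 0) (0, Q)).2
    rw [h, map_smul]
    rfl

theorem adOdd_decompose (x : CWAlg b) : g.adOdd x = g.adOdd (inDual b x.1) +
    g.adOdd (inE b x.2.1) + x.2.2.1 • g.adOdd (elP b) + x.2.2.2 • g.adOdd (elQ b) := by
  have h := congrArg g.adOddLin (CWAlg.decompose x)
  simp only [map_add, map_smul] at h
  exact h

theorem adOdd_lie (x y : CWAlg b) :
    g.adOdd ⁅x, y⁆ = g.adOdd x * g.adOdd y - g.adOdd y * g.adOdd x := by
  refine LinearMap.ext fun Q => ?_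
  have h := g.jacobi 0 0 (x, 0) (mem_parityPart_zero.mpr rfl) (y, 0) (mem_parityPart_zero.mpr rfl)
    (0, Q)
  rw [br_even_odd, br_even_odd, g.even_part, br_even_odd, br_even_odd, br_even_odd] at h
  have h2 := congrArg Prod.snd h
  simp only [ZMod.val_zero, mul_zero, pow_zero, one_smul, Prod.snd_add] at h2
  rw [LinearMap.sub_apply, Module.End.mul_apply, Module.End.mul_apply, h2, add_sub_cancel_right]

theorem lie_oddBr (x : CWAlg b) (Q R : V × V) :
    ⁅x, g.oddBr Q R⁆ = g.oddBr (g.adOdd x Q) R + g.oddBr Q (g.adOdd x R) := by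
  have h := g.jacobi 0 1 (x, 0) (mem_parityPart_zero.mpr rfl) (0, Q) (mem_parityPart_one.mpr rfl)
    (0, R)
  rw [br_odd_odd, br_even_odd, g.even_part, br_even_odd, br_odd_odd, br_odd_odd] at h
  simpa using congrArg Prod.fst h

theorem adOdd_inDual (e : E) :
    g.adOdd (inDual b (flat E e)) = √2 • block 0 (ρ (vec _ (b.B e))) 0 0 := by
  have h : g.adOdd (inDual b (flat E e)) = isotropySpin b ρ (flat E e) :=
    LinearMap.ext fun Q => congrArg Prod.snd (g.spin (flat E e) Q)
  rw [h, isotropySpin_flat, LinearEquiv.symm_apply_apply]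

end Superization

theorem CWForm.B_bijective (b : CWForm E) : Function.Bijective b.B := by
  have hinj : Function.Injective b.B := by
    rw [injective_iff_map_eq_zero]
    intro e he
    refine b.nondeg.1 e fun f => ?_
    rw [b.form_eq, he, map_zero, LinearMap.zero_apply, neg_zero]
  exact ⟨hinj, LinearMap.injective_iff_surjective.mp hinj⟩

theorem lie_flat_E (e f : E) : ⁅inDual b (flat E e), inE b f⁆ = b.form e f • elP b := by
  rw [lie_def]
  refine CWAlg.ext b ?_ ?_ ?_ ?_ <;>
    simp [br_c1, br_c2, br_c3, br_c4, smul_c1, smul_c2, smul_c3, smul_c4, inDual_fst, inDual_snd,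
      inMink_fst, inMink_snd, inE, elP]

theorem lie_flat_Q (e : E) : ⁅inDual b (flat E e), elQ b⁆ = inE b (b.B e) := by
  rw [lie_def]
  refine CWAlg.ext b ?_ ?_ ?_ ?_ <;>
    simp [br_c1, br_c2, br_c3, br_c4, inDual_fst, inDual_snd, inMink_fst,
      inMink_snd, inE, elQ]

theorem lie_Q_E (e : E) : ⁅elQ b, inE b e⁆ = inDual b (flat E e) := by
  rw [lie_def]
  refine CWAlg.ext b ?_ ?_ ?_ ?_ <;>
    simp [br_c1, br_c2, br_c3, br_c4, inDual_fst, inDual_snd, inMink_fst,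
      inMink_snd, inE, elQ]

theorem lie_elP (x : CWAlg b) : ⁅x, elP b⁆ = 0 := by
  rw [lie_def]
  refine CWAlg.ext b ?_ ?_ ?_ ?_ <;>
    simp [br_c1, br_c2, br_c3, br_c4, zero_c1, zero_c2, zero_c3, zero_c4, inMink_fst, inMink_snd,
      elP]

/-! ### Superizations given by data -/

namespace Superization.IsGivenBy

variable {Sm Sp : Submodule ℝ V} {g g' : Superization b ρ} {D D' : SuperizationData b ρ Sm Sp}

theorem oddBr_eq (h : g.IsGivenBy D) (Q R : V × V) :
    g.oddBr Q R = (D.ppp Q.2 R.2 + D.pmp Q.1 R.2 + D.pmp R.1 Q.2) • elP b := by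
  have h1 := g.oddBr_polarize Q R
  rw [h.odd, h.odd, h.odd, ← sub_smul, ← sub_smul] at h1
  have h2 := congrArg (fun x => (1 / 2 : ℝ) • x) h1
  simp only [smul_smul] at h2
  rw [show (1 / 2 * 2 : ℝ) = 1 by norm_num, one_smul] at h2
  rw [h2]
  congr 1
  simp only [Prod.fst_add, Prod.snd_add, map_add, LinearMap.add_apply, D.ppp_symm R.2 Q.2]
  ring

theorem unique (h : g.IsGivenBy D) (h' : g'.IsGivenBy D) : g' = g := by
  have had : ∀ x, g'.adOdd x = g.adOdd x := by
    intro x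
    have hx := (flat E).apply_symm_apply x.1
    rw [g.adOdd_decompose, g'.adOdd_decompose, ← hx, h.ad_p, h'.ad_p, h.ad_q, h'.ad_q, h.ad_dual,
      h'.ad_dual, h.ad_E, h'.ad_E]
  refine Superization.ext_br (LinearMap.ext₂ ?_)
  rintro ⟨x, Q⟩ ⟨y, R⟩
  rw [g.br_mk, g'.br_mk, had, had, h.oddBr_eq, h'.oddBr_eq]

theorem data_eq (h : g.IsGivenBy D) (h' : g.IsGivenBy D') :
    ρ D.c₁ = ρ D'.c₁ ∧ ρ D.c₂ = ρ D'.c₂ ∧ ρ D.c₃ = ρ D'.c₃ ∧ D.pmp = D'.pmp ∧ D.ppp = D'.ppp := by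
  obtain ⟨h1, h3, -, h2⟩ := block_inj.mp (h.ad_q.symm.trans h'.ad_q)
  have hodd : ∀ Q R : V × V, D.ppp Q.2 R.2 + D.pmp Q.1 R.2 + D.pmp R.1 Q.2 =
      D'.ppp Q.2 R.2 + D'.pmp Q.1 R.2 + D'.pmp R.1 Q.2 := fun Q R =>
    smul_left_injective ℝ elP_ne_zero ((h.oddBr_eq Q R).symm.trans (h'.oddBr_eq Q R))
  refine ⟨h1, h2, h3, LinearMap.ext₂ fun s t => ?_, LinearMap.ext₂ fun s t => ?_⟩
  · simpa using hodd (s, 0) (0, t)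
  · simpa using hodd (0, s) (0, t)

theorem congr_data (h : g.IsGivenBy D) (h1 : ρ D.c₁ = ρ D'.c₁) (h2 : ρ D.c₂ = ρ D'.c₂)
    (h3 : ρ D.c₃ = ρ D'.c₃) (hm : D.pmp = D'.pmp) (hp : D.ppp = D'.ppp) : g.IsGivenBy D' where
  ad_p := h.ad_p
  ad_q := by rw [h.ad_q, h1, h2, h3]
  ad_dual := h.ad_dual
  ad_E e := by rw [h.ad_E, h1, h2]
  odd Q := by rw [h.odd, hm, hp]

end Superization.IsGivenBy

namespace SuperizationData

variable {Sm Sp : Submodule ℝ V} (D : SuperizationData b ρ Sm Sp)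

/-- The Clifford element in the upper right block of the action of `ξ + e ∈ E* + E`. -/
def upper : CWAlg b →ₗ[ℝ] Cl (euc E) where
  toFun x := vec _ (b.B ((flat E).symm x.1)) + vec _ x.2.1 * D.c₂ - D.c₁ * vec _ x.2.1
  map_add' x y := by
    simp only [add_c1, add_c2, map_add]
    noncomm_ring
  map_smul' r x := by
    simp only [smul_c1, smul_c2, map_smul, RingHom.id_apply, smul_mul_assoc, mul_smul_comm]
    module

theorem upper_apply (x : CWAlg b) : D.upper x =
    vec _ (b.B ((flat E).symm x.1)) + vec _ x.2.1 * D.c₂ - D.c₁ * vec _ x.2.1 := rfl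

/-- The representation of the Cahen-Wallach algebra on `S` defined by the data. -/
def action : CWAlg b →ₗ[ℝ] Module.End ℝ (V × V) where
  toFun x := √2 • block 0 (ρ (D.upper x)) 0 0 + x.2.2.2 • block (ρ D.c₁) (ρ D.c₃) 0 (ρ D.c₂)
  map_add' x y := by
    simp only [map_add, add_c4, smul_block, block_add, block_inj]
    refine ⟨?_, ?_, ?_, ?_⟩ <;> module
  map_smul' r x := by
    simp only [map_smul, smul_c4, smul_block, block_add, block_inj, RingHom.id_apply]
    refine ⟨?_, ?_, ?_, ?_⟩ <;> module

theorem action_eq (x : CWAlg b) : D.action x =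
    √2 • block 0 (ρ (D.upper x)) 0 0 + x.2.2.2 • block (ρ D.c₁) (ρ D.c₃) 0 (ρ D.c₂) := rfl

theorem action_apply (x : CWAlg b) (Q : V × V) : D.action x Q =
    (√2 • ρ (D.upper x) Q.2 + x.2.2.2 • (ρ D.c₁ Q.1 + ρ D.c₃ Q.2), x.2.2.2 • ρ D.c₂ Q.2) := by
  refine Prod.ext ?_ ?_ <;> simp [action_eq, block_apply]

/-- Put `T = L_{c₁} - R_{c₂}`. On `E*` the upper block is `B e`, on `E` it is `-T e`; the relation
`T² e = -B e` says that `ad_q` corresponds to `T`. -/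
theorem upper_lie (x y : CWAlg b) : D.upper ⁅x, y⁆ =
    x.2.2.2 • (D.c₁ * D.upper y - D.upper y * D.c₂) -
      y.2.2.2 • (D.c₁ * D.upper x - D.upper x * D.c₂) := by
  have hq : ∀ e, vec (euc E) (b.B e) =
      -(D.c₁ * (D.c₁ * vec _ e - vec _ e * D.c₂) - (D.c₁ * vec _ e - vec _ e * D.c₂) * D.c₂) := by
    intro e
    rw [← sq_mulLeft_sub_mulRight, D.quadratic.2, neg_neg]
  simp only [upper_apply, lie_def, br_c1, br_c2, map_sub, map_smul, LinearEquiv.symm_apply_apply]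
  rw [hq x.2.1, hq y.2.1]
  simp only [mul_add, mul_sub, add_mul, sub_mul, smul_mul_assoc, mul_smul_comm, smul_sub, smul_add,
    mul_assoc]
  module

theorem action_lie (x y : CWAlg b) :
    D.action ⁅x, y⁆ = D.action x * D.action y - D.action y * D.action x := by
  have h4 : (⁅x, y⁆ : CWAlg b).2.2.2 = 0 := rfl
  refine LinearMap.ext fun Q => ?_
  simp only [LinearMap.sub_apply, Module.End.mul_apply, action_apply, h4, upper_lie, map_sub,
    map_smul, map_mul, map_add, LinearMap.smul_apply,
    Module.End.mul_apply]
  refine Prod.ext ?_ ?_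
  · simp only [Prod.fst_sub]
    module
  · simp only [Prod.snd_sub]
    module

/-- The bracket of odd elements defined by the data. -/
def pairing : LinearMap.BilinForm ℝ (V × V) :=
  LinearMap.mk₂ ℝ (fun Q R => D.ppp Q.2 R.2 + D.pmp Q.1 R.2 + D.pmp R.1 Q.2)
    (by intro Q Q' R; simp; ring) (by intro r Q R; simp; ring)
    (by intro Q R R'; simp; ring) (by intro r Q R; simp; ring)

theorem pairing_apply (Q R : V × V) :
    D.pairing Q R = D.ppp Q.2 R.2 + D.pmp Q.1 R.2 + D.pmp R.1 Q.2 := rfl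

/-- The second compatibility condition turns `p_{-+}(e c₂ s, t)` into `p_{-+}(c₁ e t, s)`, so the
`E`-contribution is visibly antisymmetrized; the `E*`-contribution is a vector. -/
theorem isVecSkew_upper (x : CWAlg b) (s t : V) :
    D.pmp (ρ (D.upper x) s) t = -D.pmp (ρ (D.upper x) t) s := by
  have hskew := isVecSkew_of_mem D.pmp_mem
  have h2 : ∀ s t, D.pmp s (ρ D.c₂ t) = -D.pmp (ρ D.c₁ s) t := fun s t =>
    eq_neg_of_add_eq_zero_right (D.compat₂ s t)
  have h3 : ∀ (e : E) (s t : V), D.pmp (ρ (vec _ e) (ρ D.c₂ s)) t =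
      D.pmp (ρ D.c₁ (ρ (vec _ e) t)) s := by
    intro e s t
    rw [hskew, h2, neg_neg]
  simp only [upper_apply, map_sub, map_add, map_mul, LinearMap.sub_apply, LinearMap.add_apply,
    Module.End.mul_apply, h3]
  rw [hskew]
  ring

theorem pairing_invariant (x : CWAlg b) (Q R : V × V) :
    D.pairing (D.action x Q) R + D.pairing Q (D.action x R) = 0 := by
  have h1 := D.compat₁ Q.2 R.2
  have h2 := D.compat₂ Q.1 R.2
  have h2' := D.compat₂ R.1 Q.2
  have h3 := D.isVecSkew_upper x Q.2 R.2
  simp only [pairing_apply, action_apply, map_add, map_smul, LinearMap.add_apply,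
    LinearMap.smul_apply, smul_eq_mul]
  linear_combination x.2.2.2 * h1 + x.2.2.2 * h2 + x.2.2.2 * h2' + √2 * h3

theorem action_elP : D.action (elP b) = 0 := by
  refine LinearMap.ext fun Q => ?_
  simp [action_apply, upper_apply, elP, inMink_fst, inMink_snd]

/-- The superization defined by the data. -/
def superization : Superization b ρ where
  toLieSuperalgebraOn := LieSuperalgebraOn.ofRepresentation D.action
    (D.pairing.compr₂ (LinearMap.toSpanSingleton ℝ (CWAlg b) (elP b)))
    (fun x y Q => by rw [D.action_lie]; rfl)
    (fun Q R => by
      simp only [LinearMap.compr₂_apply, pairing_apply, D.ppp_symm Q.2]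
      congr 1
      ring)
    (fun x Q R => by
      simp only [LinearMap.compr₂_apply, LinearMap.toSpanSingleton_apply]
      rw [← add_smul, D.pairing_invariant, lie_smul, lie_elP, smul_zero, zero_smul])
    (fun Q R T => by
      simp only [LinearMap.compr₂_apply, LinearMap.toSpanSingleton_apply, map_smul, action_elP,
        smul_zero, LinearMap.zero_apply, add_zero])
  even_part x y := by
    simp [LieSuperalgebraOn.ofRepresentation]
  spin ξ Q := by
    have h : D.action (inDual b ξ) = isotropySpin b ρ ξ := by
      rw [isotropySpin_flat, action_eq]
      simp [upper_apply, inDual_fst, inDual_snd]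
    simp [LieSuperalgebraOn.ofRepresentation, h]

theorem adOdd_superization (x : CWAlg b) : D.superization.adOdd x = D.action x := by
  refine LinearMap.ext fun Q => ?_
  simp [Superization.adOdd, superization, LieSuperalgebraOn.ofRepresentation]

theorem oddBr_superization (Q R : V × V) :
    D.superization.oddBr Q R = D.pairing Q R • elP b := by
  simp [Superization.oddBr, superization, LieSuperalgebraOn.ofRepresentation]

theorem superization_isGivenBy : D.superization.IsGivenBy D where
  ad_p := by rw [adOdd_superization, action_elP]
  ad_q := by
    rw [adOdd_superization, action_eq, smul_block, smul_block, block_add, block_inj]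
    simp [upper_apply, elQ, inMink_fst, inMink_snd]
  ad_dual e := D.superization.adOdd_inDual e
  ad_E e := by
    rw [adOdd_superization, action_eq]
    simp [upper_apply, inE, inMink_fst, inMink_snd]
    rfl
  odd Q := by
    rw [oddBr_superization, pairing_apply]
    congr 1
    ring

theorem superization_isZeroChargeTranslational : D.superization.IsZeroChargeTranslational where
  zero_charge := D.superization_isGivenBy.ad_p
  clifford v := by
    obtain ⟨c, hc⟩ := block_mem_range_spinRep ρ (v.2.2 • D.c₁)
      (√2 • D.upper (inMink b v) + v.2.2 • D.c₃) 0 (v.2.2 • D.c₂)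
    refine ⟨c, ?_⟩
    rw [adOdd_superization, action_eq, inMink_snd, smul_block, smul_block, block_add]
    refine Eq.trans ?_ hc.symm
    simp
  translational Q R := ⟨(0, D.pairing Q R, 0), by
    rw [oddBr_superization, elP, ← map_smul]
    simp⟩

end SuperizationData

/-! ### Zero charge superizations with translational supersymmetry -/

namespace Superization

variable {g : Superization b ρ}

namespace IsZeroChargeTranslational

variable (h : g.IsZeroChargeTranslational)

include h

theorem oddBr_fst (Q R : V × V) : (g.oddBr Q R).1 = 0 := by
  obtain ⟨v, hv⟩ := h.translational Q R
  rw [hv, inMink_fst]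

/-- Odd brackets have no `E*`-component, hence neither has their image under `ad_x`, by
equivariance. For `x = q` that component is the flat of the `E`-part; for `x = e ≠ 0` it is `e♭`
times minus the `q`-coefficient. -/
theorem oddBr_mem_span_elP [Nontrivial E] (Q R : V × V) :
    g.oddBr Q R = (g.oddBr Q R).2.2.1 • elP b := by
  have h1 := h.oddBr_fst Q R
  have hE : ∀ Q R, (g.oddBr Q R).2.1 = 0 := by
    intro Q R
    have h2 := congrArg (fun x : CWAlg b => x.1) (g.lie_oddBr (elQ b) Q R)
    simp only [lie_def, br_c1, add_c1, h.oddBr_fst, add_zero, elQ, inMink_snd, map_zero, smul_zero,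
      sub_zero, one_smul] at h2
    exact (flat E).map_eq_zero_iff.mp h2
  have hQ : (g.oddBr Q R).2.2.2 = 0 := by
    obtain ⟨e, he⟩ := exists_ne (0 : E)
    have h2 := congrArg (fun x : CWAlg b => x.1) (g.lie_oddBr (inE b e) Q R)
    simp only [lie_def, br_c1, add_c1, h.oddBr_fst, add_zero, inE, inMink_snd, zero_smul, zero_sub,
      neg_eq_zero, smul_eq_zero, LinearEquiv.map_eq_zero_iff, he, or_false] at h2
    exact h2
  refine CWAlg.ext b ?_ ?_ ?_ ?_
  · simp [h1, smul_c1, elP, inMink_fst]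
  · simp [hE, smul_c2, elP, inMink_snd]
  · simp [smul_c3, elP, inMink_snd]
  · simp [hQ, smul_c4, elP, inMink_snd]

end IsZeroChargeTranslational

/-- The coefficient of `p` in the bracket of odd elements. -/
def oddCoeff (g : Superization b ρ) : LinearMap.BilinForm ℝ (V × V) :=
  g.oddBracket.compr₂ (LinearMap.fst ℝ ℝ ℝ ∘ₗ LinearMap.snd ℝ E (ℝ × ℝ) ∘ₗ
    LinearMap.snd ℝ (Module.Dual ℝ E) (Mink E))

theorem oddCoeff_apply (g : Superization b ρ) (Q R : V × V) :
    g.oddCoeff Q R = (g.oddBr Q R).2.2.1 := rfl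

theorem IsZeroChargeTranslational.oddCoeff_invariant [Nontrivial E]
    (h : g.IsZeroChargeTranslational) (x : CWAlg b) (Q R : V × V) :
    g.oddCoeff (g.adOdd x Q) R + g.oddCoeff Q (g.adOdd x R) = 0 := by
  have h1 := g.lie_oddBr x Q R
  rw [h.oddBr_mem_span_elP Q R, lie_smul, lie_elP, smul_zero] at h1
  rw [oddCoeff_apply, oddCoeff_apply, ← add_c3, ← h1, zero_c3]

theorem IsZeroChargeTranslational.exists_data [Nontrivial E] [Nontrivial V] {Sm Sp : Submodule ℝ V}
    (hS : ¬ SoIrreducible ρ (⊤ : Submodule ℝ V) → IsSemispinorSplitting ρ Sm Sp)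
    (h : g.IsZeroChargeTranslational) : ∃ D : SuperizationData b ρ Sm Sp, g.IsGivenBy D := by
  have h2 : √2 ≠ 0 := by positivity
  obtain ⟨c, hc⟩ := h.clifford (0, 0, 1)
  obtain ⟨a₁, c₃, c₄, a₂, hblock⟩ := exists_block_eq_spinRep ρ c
  have hq : g.adOdd (elQ b) = block (ρ a₁) (ρ c₃) (ρ c₄) (ρ a₂) := hc.trans hblock
  have hE : ∀ e, g.adOdd (inE b e) = √2 • block (ρ (vec _ e) * ρ c₄)
      (ρ (vec _ e) * ρ a₂ - ρ a₁ * ρ (vec _ e)) 0 (-(ρ c₄ * ρ (vec _ e))) := by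
    intro e
    obtain ⟨f, rfl⟩ := b.B_bijective.2 e
    rw [← lie_flat_Q, adOdd_lie, adOdd_inDual, hq, smul_block, smul_block, block_mul, block_mul,
      block_sub, block_inj]
    simp [smul_sub]
  -- For `v = B f` the bracket `[f♭, v]` is a multiple of `p`, so it acts by zero. The upper right
  -- block of the commutator is `-4 v c₄ v`, and `v ≠ 0` acts invertibly.
  have hc₄ : ρ c₄ = 0 := by
    obtain ⟨e, he⟩ := exists_ne (0 : E)
    obtain ⟨f, rfl⟩ := b.B_bijective.2 e
    have h3 := g.adOdd_lie (inDual b (flat E f)) (inE b (b.B f))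
    have hp : g.adOdd (b.form f (b.B f) • elP b) = 0 := by
      have := g.adOddLin.map_smul (b.form f (b.B f)) (elP b)
      exact this.trans ((congrArg _ h.zero_charge).trans (smul_zero _))
    rw [lie_flat_E, hp, adOdd_inDual, hE] at h3
    have h4 : ∀ s, ρ c₄ (ρ (vec _ (b.B f)) s) = 0 := by
      intro s
      refine vec_injective (ρ := ρ) he ?_
      have h5 := congrArg Prod.fst (LinearMap.congr_fun h3 (0, s))
      simp only [LinearMap.zero_apply, LinearMap.sub_apply, Module.End.mul_apply,
        LinearMap.smul_apply, block_apply, Prod.fst_sub, Prod.fst_zero, Prod.smul_fst, map_zero,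
        zero_add, add_zero, LinearMap.neg_apply, map_neg, map_smul] at h5
      have h6 : (√2 * √2 * 2) • ρ (vec _ (b.B f)) (ρ c₄ (ρ (vec _ (b.B f)) s)) = 0 := by
        rw [← neg_eq_zero, h5]
        module
      exact (smul_eq_zero.mp h6).resolve_left (by positivity)
    refine LinearMap.ext fun s => ?_
    have h5 := h4 (ρ (vec _ (b.B f)) s)
    rw [vec_vec_apply, map_smul] at h5
    exact (smul_eq_zero.mp h5).resolve_left (inner_self_ne_zero.mpr he)
  simp only [hc₄, mul_zero, zero_mul, neg_zero] at hE hq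
  obtain ⟨c₁, c₂, h1, h2', hquad⟩ := exists_quadraticClifford_lift b ρ a₁ a₂ fun e => by
    have h3 := g.adOdd_lie (elQ b) (inE b e)
    rw [lie_Q_E, adOdd_inDual, hq, hE, smul_block, smul_block, block_mul, block_mul, block_sub,
      block_inj] at h3
    have h4 := h3.2.1
    simp only [smul_zero, mul_zero, zero_mul, zero_add, add_zero, mul_smul_comm,
      smul_mul_assoc] at h4
    have h5 := smul_right_injective (Module.End ℝ V) h2 (h4.trans (smul_sub √2 _ _).symm)
    simp only [map_sub, map_mul]
    rw [h5]
    noncomm_ring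
  rw [← h1, ← h2'] at hq
  simp only [← h1, ← h2'] at hE
  have hinv := h.oddCoeff_invariant
  -- The operator `ad_{f♭}` annihilates `S₋` and maps `S₊` onto it, so invariance makes `S₋`
  -- isotropic.
  have hmm : ∀ s t, g.oddCoeff (s, 0) (t, 0) = 0 := by
    intro s t
    obtain ⟨e, he⟩ := exists_ne (0 : E)
    obtain ⟨f, rfl⟩ := b.B_bijective.2 e
    have h3 := hinv (inDual b (flat E f)) (0, ρ (vec _ (b.B f)) s) (t, 0)
    have h4 : (0 : V × V) = (0, 0) := rfl
    simp only [adOdd_inDual, LinearMap.smul_apply, block_apply, map_zero, LinearMap.zero_apply,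
      zero_add, add_zero, vec_vec_apply, ← h4, smul_zero] at h3
    have h5 : ∀ r : ℝ, ((r • s, 0) : V × V) = r • (s, 0) := by simp
    rw [h5, map_smul, map_smul, LinearMap.smul_apply, LinearMap.smul_apply, smul_smul,
      smul_eq_zero] at h3
    exact h3.resolve_left (mul_ne_zero h2 (inner_self_ne_zero.mpr he))
  have hsymm : ∀ Q R, g.oddCoeff Q R = g.oddCoeff R Q := by
    intro Q R
    rw [oddCoeff_apply, oddCoeff_apply, oddBr_comm]
  have hadd : ∀ s t : V, ((s, t) : V × V) = (s, 0) + (0, t) := by simp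
  let pmp : LinearMap.BilinForm ℝ V :=
    g.oddCoeff.compl₁₂ (LinearMap.inl ℝ V V) (LinearMap.inr ℝ V V)
  let ppp : LinearMap.BilinForm ℝ V :=
    g.oddCoeff.compl₁₂ (LinearMap.inr ℝ V V) (LinearMap.inr ℝ V V)
  have hpmp : ∀ s t, g.oddCoeff (s, 0) (0, t) = pmp s t := fun _ _ => rfl
  have hppp : ∀ s t, g.oddCoeff (0, s) (0, t) = ppp s t := fun _ _ => rfl
  have hcoeff : ∀ s t s' t', g.oddCoeff (s, t) (s', t') = ppp t t' + pmp s t' + pmp s' t := by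
    intro s t s' t'
    rw [hadd s t, hadd s' t', map_add, map_add, LinearMap.add_apply, LinearMap.add_apply, hmm,
      hsymm (0, t) (s', 0), hpmp, hpmp, hppp]
    ring
  refine ⟨⟨c₁, c₂, c₃, pmp, ppp, hquad, ?_, fun s t => hsymm _ _, fun s t => ?_, fun s t => ?_⟩,
    ?_⟩
  -- Invariance under `f♭` on a pair in `S₊` is the skewness condition for the vector `B f`, and
  -- these exhaust `E`.
  · refine IsVecSkew.mem_bilTauSigmaNeg hS fun e s t => ?_
    obtain ⟨f, rfl⟩ := b.B_bijective.2 e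
    have h3 := hinv (inDual b (flat E f)) (0, s) (0, t)
    rw [adOdd_inDual, LinearMap.smul_apply, LinearMap.smul_apply, map_smul, map_smul,
      LinearMap.smul_apply, ← smul_add] at h3
    have h4 := (smul_eq_zero.mp h3).resolve_left h2
    simp only [block_apply, hcoeff, map_zero, LinearMap.zero_apply, zero_add, add_zero] at h4
    exact eq_neg_of_add_eq_zero_left h4
  · have h3 := hinv (elQ b) (0, s) (0, t)
    rw [hq] at h3
    simp only [block_apply, hcoeff, map_zero, LinearMap.zero_apply, zero_add, add_zero] at h3
    linear_combination h3
  · have h3 := hinv (elQ b) (s, 0) (0, t)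
    rw [hq] at h3
    simp only [block_apply, hcoeff, map_zero, LinearMap.zero_apply, zero_add, add_zero] at h3
    linear_combination h3
  · refine ⟨h.zero_charge, hq, g.adOdd_inDual, hE, fun Q => ?_⟩
    rw [h.oddBr_mem_span_elP Q Q, ← oddCoeff_apply]
    change g.oddCoeff (Q.1, Q.2) (Q.1, Q.2) • _ = _
    rw [hcoeff]
    congr 1
    ring

end Superization

end Brackets

end CahenWallach

end

theorem theorem5p1
    {E : Type*} [NormedAddCommGroup E] [InnerProductSpace ℝ E] [FiniteDimensional ℝ E]
    (n : ℕ) (hn : 2 ≤ n) (hE : Module.finrank ℝ E + 1 = n)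
    (b : CahenWallach.CWForm E)
    {V : Type*} [AddCommGroup V] [Module ℝ V]
    (ρ : CahenWallach.Cl (CahenWallach.euc E) →ₐ[ℝ] Module.End ℝ V)
    (hρ : CahenWallach.IsSpinModule ρ)
    (Sm Sp : Submodule ℝ V)
    (hS : ¬ CahenWallach.SoIrreducible ρ (⊤ : Submodule ℝ V) →
      CahenWallach.IsSemispinorSplitting ρ Sm Sp) :
    -- every admissible set of data defines a unique superization, of the required kind
    (∀ D : CahenWallach.SuperizationData b ρ Sm Sp,
      ∃ g : CahenWallach.Superization b ρ,
        g.IsZeroChargeTranslational ∧ g.IsGivenBy D ∧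
          ∀ g' : CahenWallach.Superization b ρ, g'.IsGivenBy D → g' = g) ∧
    -- every superization of the required kind arises in this way
    (∀ g : CahenWallach.Superization b ρ, g.IsZeroChargeTranslational →
      ∃ D : CahenWallach.SuperizationData b ρ Sm Sp, g.IsGivenBy D) ∧
    -- the data are unique, the triple up to elements of the kernel of the spin representation
    (∀ (g : CahenWallach.Superization b ρ) (D D' : CahenWallach.SuperizationData b ρ Sm Sp),
      g.IsGivenBy D →
        (g.IsGivenBy D' ↔
          ρ (D.c₁ - D'.c₁) = 0 ∧ ρ (D.c₂ - D'.c₂) = 0 ∧ ρ (D.c₃ - D'.c₃) = 0 ∧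
            D.pmp = D'.pmp ∧ D.ppp = D'.ppp)) := by
  -- The bound `n ≥ 2` supplies a non-zero vector of `E`, needed to kill the `q`-coefficient of odd
  -- brackets, the block `c₄` and the form on `S₋`.
  have hnontriv : Nontrivial E := Module.nontrivial_of_finrank_pos (R := ℝ) (by omega)
  have := hρ.1
  refine ⟨fun D => ⟨D.superization, D.superization_isZeroChargeTranslational,
    D.superization_isGivenBy, fun g' h => D.superization_isGivenBy.unique h⟩,
    fun g h => h.exists_data hS, fun g D D' h => ?_⟩
  simp only [map_sub, sub_eq_zero]
  exact ⟨h.data_eq, fun ⟨h1, h2, h3, h4, h5⟩ => h.congr_data h1 h2 h3 h4 h5⟩
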